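/- Let $G$ be a finite connected graph with clique number $\omega(G)=3$ in which every edge has degree at least $2$, where the degree of an edge is the number of triangles of $G$ that contain it. Suppose that $G$ admits a unit disk graph structure, that is, an injective map $f:V(G)\to\mathbb{R}^2$ such that distinct vertices $u,v$ are adjacent if and only if the Euclidean distance of $f(u)$ and $f(v)$ is less than $1$; let $f$ be any such map and draw every edge $uv$ as the straight segment from $f(u)$ to $f(v)$. Two distinct edges are said to cross if their segments have a common point in their relative interiors. A copy of $K_{2,2,2}$ is an induced subgraph of $G$ isomorphic to the complete tripartite graph $K_{2,2,2}$. Then: 1. $G$ contains a copy of $K_{2,2,2}$. 2. Every edge of $G$ is contained in at most two distinct copies of $K_{2,2,2}$. 3. Every edge of degree at least $3$ is contained in at least one copy of $K_{2,2,2}$. 4. For any two crossing edges $e_1,e_2$ there is exactly one copy of $K_{2,2,2}$ that contains both $e_1$ and $e_2$. 5. Every copy of $K_{2,2,2}$ is drawn non-planarly: its six vertices are the vertices of a convex hexagon (none lies in the convex hull of the other five), and exactly six unordered pairs of its edges cross. 6. The number of copies of $K_{2,2,2}$ in $G$ is exactly $k/6$, where $k$ is the number of unordered pairs of crossing edges of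 $G$. -/

import Mathlib

/-- An injective placement of the vertices in the Euclidean plane realizes `G` as a unit disk graph
if two distinct vertices are adjacent exactly when their distance is less than `1`. -/
def IsUnitDiskRealization {V : Type*} (G : SimpleGraph V)
    (f : V → EuclideanSpace ℝ (Fin 2)) : Prop :=
  Function.Injective f ∧ ∀ u v : V, u ≠ v → (G.Adj u v ↔ dist (f u) (f v) < 1)

/-- The degree of an edge: the number of triangles (3-cliques) that contain both its endpoints. -/
noncomputable def edgeDegree {V : Type*} (G : SimpleGraph V) (e : Sym2 V) : ℕ :=
  {t : Finset V | G.IsNClique 3 t ∧ ∀ v ∈ e, v ∈ t}.ncard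

/-- The complete tripartite graph `K_{2,2,2}`, with parts indexed by `Fin 3`. -/
abbrev K222 : SimpleGraph (Σ _ : Fin 3, Fin 2) :=
  SimpleGraph.completeMultipartiteGraph (fun _ : Fin 3 => Fin 2)

/-- `S` is the vertex set of an induced subgraph of `G` isomorphic to `K_{2,2,2}`. -/
def IsInducedK222 {V : Type*} (G : SimpleGraph V) (S : Finset V) : Prop :=
  Nonempty (G.induce (S : Set V) ≃g K222)

/-- The interior of the straight segment that represents `e` under the placement `f`. -/
def edgeInterior {V : Type*} (f : V → EuclideanSpace ℝ (Fin 2)) (e : Sym2 V) :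
    Set (EuclideanSpace ℝ (Fin 2)) :=
  {p | ∃ u v : V, e = s(u, v) ∧ p ∈ openSegment ℝ (f u) (f v)}

/-- Two distinct edges of `G` whose segments intersect at their interiors. -/
def Crossing {V : Type*} (G : SimpleGraph V) (f : V → EuclideanSpace ℝ (Fin 2))
    (e₁ e₂ : Sym2 V) : Prop :=
  e₁ ∈ G.edgeSet ∧ e₂ ∈ G.edgeSet ∧ e₁ ≠ e₂ ∧
    (edgeInterior f e₁ ∩ edgeInterior f e₂).Nonempty

/-- The unordered pairs of crossing edges of `G`. -/
def crossingPairs {V : Type*} (G : SimpleGraph V) (f : V → EuclideanSpace ℝ (Fin 2)) :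
    Set (Sym2 (Sym2 V)) :=
  {P | ∃ e₁ e₂ : Sym2 V, P = s(e₁, e₂) ∧ Crossing G f e₁ e₂}

/-- The unordered pairs of crossing edges of `G` all of whose endpoints lie in `S`. -/
def crossingPairsIn {V : Type*} (G : SimpleGraph V) (f : V → EuclideanSpace ℝ (Fin 2))
    (S : Finset V) : Set (Sym2 (Sym2 V)) :=
  {P | P ∈ crossingPairs G f ∧ ∀ e ∈ P, ∀ v ∈ e, v ∈ S}

/-! Everything rests on one inequality: if the segments `ab` and `cd` meet, then |ac| + |bd| ≤ |ab|
+ |cd| (`SegmentsMeet.dist_le`). Edges are shorter than 1 and non-edges are not, so a crossing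
forces adjacencies among the four endpoints and comparisons of lengths. Since balls are convex, a
further vertex inside a drawn triangle would be adjacent to all its corners and give a `K₄`; hence
triangles are nondegenerate and empty, and no vertex lies on an edge.

At a crossing exactly one of the four remaining pairs of endpoints is non-adjacent, so the endpoints
form a crossing path p₀p₁p₂p₃ (`IsUnitDiskComplex.exists_isCrossingPath`). The heart is
`IsCrossingPath.extend_aux`: the degree condition gives further common neighbours p₄ of p₀, p₂ and
p₅ of p₁, p₃, and the length comparisons force p₁p₂p₃p₄ to be a crossing path again. Repeating this
closes up to a hexagon whose opposite vertices are exactly the non-adjacent pairs: an octahedron.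
Its sides are shorter than the adjacent short diagonals, which makes it rigid: a short diagonal has
just two common neighbours (`IsCrossingPath.eq_of_adj_diagonal`), and any edge has at most two on
each side (`IsUnitDiskComplex.eq_of_same_side`). So a crossing determines its octahedron, and an
edge together with one of its sides determines at most one octahedron.

Crossings come from two common neighbours on the same side of an edge
(`IsUnitDiskComplex.same_side`). For an edge of degree three these exist by pigeonhole; in the whole
graph, and inside any octahedron, they exist at an extreme edge
(`IsUnitDiskComplex.exists_isCrossingPath_mem`). Thus every octahedron is drawn as a convex hexagon
with six crossings, and sending a crossing to its octahedron is six-to-one. -/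

/-! ### Plane geometry of segments and triangles -/

/-- Twice the signed area of the triangle `a b c`. -/
def orient (a b c : EuclideanSpace ℝ (Fin 2)) : ℝ :=
  (b 0 - a 0) * (c 1 - a 1) - (b 1 - a 1) * (c 0 - a 0)

/-- The closed segments `a b` and `c d` have a common point. -/
def SegmentsMeet (a b c d : EuclideanSpace ℝ (Fin 2)) : Prop :=
  (segment ℝ a b ∩ segment ℝ c d).Nonempty

/-- `y` is a convex combination of `u`, `v`, `x`. -/
def InTriangle (u v x y : EuclideanSpace ℝ (Fin 2)) : Prop :=
  ∃ A B C : ℝ, 0 ≤ A ∧ 0 ≤ B ∧ 0 ≤ C ∧ A + B + C = 1 ∧ y = A • x + B • u + C • v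

theorem orient_swap_right (a b c : EuclideanSpace ℝ (Fin 2)) : orient a c b = -orient a b c := by
  unfold orient; ring

theorem orient_rotate (a b c : EuclideanSpace ℝ (Fin 2)) : orient b c a = orient a b c := by
  unfold orient; ring

theorem SegmentsMeet.symm {a b c d : EuclideanSpace ℝ (Fin 2)} (h : SegmentsMeet a b c d) :
    SegmentsMeet c d a b := by
  unfold SegmentsMeet at *; rwa [Set.inter_comm]

theorem SegmentsMeet.swap_left {a b c d : EuclideanSpace ℝ (Fin 2)} (h : SegmentsMeet a b c d) :
    SegmentsMeet b a c d := by
  unfold SegmentsMeet at *; rwa [segment_symm]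

theorem SegmentsMeet.swap_right {a b c d : EuclideanSpace ℝ (Fin 2)} (h : SegmentsMeet a b c d) :
    SegmentsMeet a b d c :=
  h.symm.swap_left.symm

/-- Two triangle inequalities through the common point. -/
theorem SegmentsMeet.dist_le {a b c d : EuclideanSpace ℝ (Fin 2)} (h : SegmentsMeet a b c d) :
    dist a c + dist b d ≤ dist a b + dist c d := by
  obtain ⟨x, h1, h2⟩ := h
  have e1 := dist_add_dist_of_mem_segment h1
  have e2 := dist_add_dist_of_mem_segment h2
  have t1 := dist_triangle a x c
  have t2 := dist_triangle b x d
  rw [dist_comm x c] at t1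
  rw [dist_comm b x] at t2
  linarith

theorem InTriangle.dist_lt {u v x y t : EuclideanSpace ℝ (Fin 2)} {r : ℝ}
    (h : InTriangle u v x y) (hu : dist t u < r) (hv : dist t v < r) (hx : dist t x < r) :
    dist t y < r := by
  obtain ⟨A, B, C, hA, hB, hC, hs, rfl⟩ := h
  have hc := convex_ball t r
  rw [dist_comm, ← Metric.mem_ball] at hu hv hx ⊢
  rcases hC.eq_or_lt with rfl | hC'
  · simpa using hc hx hu hA hB (by linarith)
  · rcases hA.eq_or_lt with rfl | hA'
    · simpa using hc hu hv hB hC (by linarith)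
    · have hAB : 0 < A + B := by linarith
      have h1 : (A / (A + B)) • x + (B / (A + B)) • u ∈ Metric.ball t r :=
        hc hx hu (by positivity) (by positivity) (by field_simp)
      have h2 := hc h1 hv hAB.le hC hs
      rw [smul_add, smul_smul, smul_smul, mul_div_cancel₀ _ hAB.ne', mul_div_cancel₀ _ hAB.ne'] at h2
      exact h2

theorem exists_barycentric {u v x : EuclideanSpace ℝ (Fin 2)} (h : orient u v x ≠ 0)
    (y : EuclideanSpace ℝ (Fin 2)) :
    ∃ A B C : ℝ, A + B + C = 1 ∧ y = A • x + B • u + C • v ∧ orient u v y = A * orient u v x := by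
  refine ⟨orient u v y / orient u v x, orient v x y / orient u v x, orient x u y / orient u v x,
    ?_, ?_, ?_⟩
  · field_simp; unfold orient; ring
  · ext i
    simp only [PiLp.add_apply, PiLp.smul_apply, smul_eq_mul]
    field_simp
    fin_cases i <;> simp [orient] <;> ring
  · field_simp

theorem segmentsMeet_of_eq {a b c d : EuclideanSpace ℝ (Fin 2)} {α β γ δ : ℝ}
    (hα : 0 ≤ α) (hβ : 0 ≤ β) (hγ : 0 ≤ γ) (hδ : 0 ≤ δ) (h1 : α + β = 1) (h2 : γ + δ = 1)
    (h : α • a + β • b = γ • c + δ • d) : SegmentsMeet a b c d :=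
  ⟨α • a + β • b, ⟨α, β, hα, hβ, h1, rfl⟩, ⟨γ, δ, hγ, hδ, h2, h.symm⟩⟩

/-- The barycentric coordinate of `y` at `x` is positive; the signs of the other two coordinates
select the alternative, by moving negative terms to the other side and normalizing. -/
theorem same_side {u v x y : EuclideanSpace ℝ (Fin 2)} (h : 0 < orient u v x * orient u v y) :
    InTriangle u v x y ∨ InTriangle u v y x ∨ SegmentsMeet x v u y ∨ SegmentsMeet y v u x := by
  have hx : orient u v x ≠ 0 := by rintro h0; simp [h0] at h
  obtain ⟨A, B, C, hs, hy, ho⟩ := exists_barycentric hx y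
  have hA : 0 < A := by
    rw [ho] at h
    have : 0 < orient u v x ^ 2 := by positivity
    by_contra hA
    nlinarith
  rcases le_or_gt 0 B with hB | hB <;> rcases le_or_gt 0 C with hC | hC
  · exact Or.inl ⟨A, B, C, hA.le, hB, hC, hs, hy⟩
  · right; right; right
    have hp : 0 < 1 - C := by linarith
    refine segmentsMeet_of_eq (α := 1 / (1 - C)) (β := -C / (1 - C)) (γ := B / (1 - C))
      (δ := A / (1 - C)) (by positivity) (div_nonneg (by linarith) hp.le) (by positivity)
      (by positivity) (by field_simp; ring) (by field_simp; linarith) ?_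
    rw [hy]
    ext i
    simp only [PiLp.add_apply, PiLp.smul_apply, smul_eq_mul]
    field_simp; ring
  · right; right; left
    have hp : 0 < 1 - B := by linarith
    refine segmentsMeet_of_eq (α := A / (1 - B)) (β := C / (1 - B)) (γ := -B / (1 - B))
      (δ := 1 / (1 - B)) (by positivity) (by positivity) (div_nonneg (by linarith) hp.le)
      (by positivity) (by field_simp; linarith) (by field_simp; ring) ?_
    rw [hy]
    ext i
    simp only [PiLp.add_apply, PiLp.smul_apply, smul_eq_mul]
    field_simp; ring
  · right; left
    refine ⟨1 / A, -B / A, -C / A, by positivity, div_nonneg (by linarith) hA.le,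
      div_nonneg (by linarith) hA.le, by field_simp; linarith, ?_⟩
    rw [hy]
    ext i
    simp only [PiLp.add_apply, PiLp.smul_apply, smul_eq_mul]
    field_simp; ring

theorem orient_combo (c d a b : EuclideanSpace ℝ (Fin 2)) {s t : ℝ} (h : s + t = 1) :
    orient c d (s • a + t • b) = s * orient c d a + t * orient c d b := by
  obtain rfl : t = 1 - s := by linarith
  simp only [orient, PiLp.add_apply, PiLp.smul_apply, smul_eq_mul]
  ring

theorem orient_left_self (c d : EuclideanSpace ℝ (Fin 2)) : orient c d c = 0 := by
  simp [orient]

theorem orient_right_self (c d : EuclideanSpace ℝ (Fin 2)) : orient c d d = 0 := by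
  simp [orient]; ring

theorem orient_eq_zero_of_mem_segment {c d x : EuclideanSpace ℝ (Fin 2)} (h : x ∈ segment ℝ c d) :
    orient c d x = 0 := by
  obtain ⟨s, t, -, -, hst, rfl⟩ := h
  rw [orient_combo _ _ _ _ hst, orient_left_self, orient_right_self]; ring

/-- A segment that enters a triangle through a side leaves it through another side, unless it ends
in the triangle. -/
theorem SegmentsMeet.pasch {a b c d e : EuclideanSpace ℝ (Fin 2)} (h : SegmentsMeet a b c d)
    (ha : orient c d a * orient c d e < 0) :
    InTriangle c d e b ∨ SegmentsMeet a b c e ∨ SegmentsMeet a b d e := by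
  have he : orient c d e ≠ 0 := by rintro h0; simp [h0] at ha
  obtain ⟨q, hq, ⟨γ, β, hγ, hβ, hγβ, hq'⟩⟩ := h
  obtain ⟨s, t, hs, ht, hst, hq0⟩ := id hq
  obtain ⟨A, B, C, hABC, hb, ho⟩ := exists_barycentric he b
  -- Having met the line `c d` at `q`, the segment ends on the side opposite to `a`, that is, on the
  -- side of `e` or on the line.
  have hA : 0 ≤ A := by
    have hz : orient c d q = 0 := orient_eq_zero_of_mem_segment ⟨γ, β, hγ, hβ, hγβ, hq'⟩
    rw [← hq0, orient_combo _ _ _ _ hst, ho] at hz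
    have hz' : s * (orient c d a * orient c d e) + t * A * orient c d e ^ 2 = 0 := by
      linear_combination orient c d e * hz
    have hsq : 0 < orient c d e ^ 2 := by positivity
    by_contra hA
    push Not at hA
    rcases ht.eq_or_lt with rfl | ht'
    · have : s = 1 := by linarith
      subst this; nlinarith
    · nlinarith [mul_pos ht' hsq, mul_nonneg hs (neg_nonneg.2 ha.le)]
  have hsub : segment ℝ q b ⊆ segment ℝ a b :=
    (convex_segment a b).segment_subset hq (right_mem_segment ℝ a b)
  -- Weights proportional to `-B` at `q` and `γ` at `b` cancel the `c`-coordinate; the other two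
  -- coordinates are then nonnegative. `key2` cancels the `d`-coordinate instead.
  have key1 : B < 0 → 0 ≤ C * γ - β * B → SegmentsMeet a b d e := by
    intro hB hc
    have hp : 0 < γ - B := by linarith
    suffices SegmentsMeet q b d e by
      obtain ⟨x, h1, h2⟩ := this
      exact ⟨x, hsub h1, h2⟩
    refine segmentsMeet_of_eq (α := -B / (γ - B)) (β := γ / (γ - B))
      (γ := (C * γ - β * B) / (γ - B)) (δ := A * γ / (γ - B)) (div_nonneg (by linarith) hp.le)
      (by positivity) (by positivity) (by positivity) (by field_simp; ring) ?_ ?_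
    · field_simp
      linear_combination γ * hABC - B * hγβ
    · rw [hb, ← hq']
      ext i
      simp only [PiLp.add_apply, PiLp.smul_apply, smul_eq_mul]
      field_simp; ring
  have key2 : C < 0 → 0 ≤ B * β - γ * C → SegmentsMeet a b c e := by
    intro hC hc
    have hp : 0 < β - C := by linarith
    suffices SegmentsMeet q b c e by
      obtain ⟨x, h1, h2⟩ := this
      exact ⟨x, hsub h1, h2⟩
    refine segmentsMeet_of_eq (α := -C / (β - C)) (β := β / (β - C))
      (γ := (B * β - γ * C) / (β - C)) (δ := A * β / (β - C)) (div_nonneg (by linarith) hp.le)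
      (by positivity) (by positivity) (by positivity) (by field_simp; ring) ?_ ?_
    · field_simp
      linear_combination β * hABC - C * hγβ
    · rw [hb, ← hq']
      ext i
      simp only [PiLp.add_apply, PiLp.smul_apply, smul_eq_mul]
      field_simp; ring
  rcases lt_or_ge B 0 with hB | hB
  · rcases le_or_gt 0 (C * γ - β * B) with h1 | h1
    · exact Or.inr (Or.inr (key1 hB h1))
    · have hC : C < 0 := by
        by_contra hC
        push Not at hC
        nlinarith [mul_nonneg hC hγ, mul_nonneg hβ (neg_nonneg.2 hB.le)]
      exact Or.inr (Or.inl (key2 hC (by linarith)))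
  · rcases lt_or_ge C 0 with hC | hC
    · exact Or.inr (Or.inl (key2 hC (by nlinarith [mul_nonneg hB hβ, mul_nonneg hγ (neg_nonneg.2 hC.le)])))
    · exact Or.inl ⟨A, B, C, hA, hB, hC, hABC, hb⟩

/-- Of three collinear points one lies between the two others. -/
theorem mem_segment_of_orient_eq_zero {u v x : EuclideanSpace ℝ (Fin 2)} (huv : u ≠ v)
    (h : orient u v x = 0) : x ∈ segment ℝ u v ∨ u ∈ segment ℝ v x ∨ v ∈ segment ℝ u x := by
  have hc : Collinear ℝ {u, v, x} := by
    rw [collinear_iff_of_mem (p₀ := u) (by simp)]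
    refine ⟨v - u, ?_⟩
    have hne : v 0 - u 0 ≠ 0 ∨ v 1 - u 1 ≠ 0 := by
      by_contra! hh
      apply huv
      ext i
      fin_cases i
      · exact (sub_eq_zero.1 hh.1).symm
      · exact (sub_eq_zero.1 hh.2).symm
    unfold orient at h
    intro p hp
    rcases hp with rfl | rfl | rfl
    · exact ⟨0, by simp⟩
    · exact ⟨1, by simp⟩
    · rcases hne with hne | hne
      · refine ⟨(p 0 - u 0) / (v 0 - u 0), ?_⟩
        ext i
        fin_cases i <;> simp <;> field_simp <;> linarith
      · refine ⟨(p 1 - u 1) / (v 1 - u 1), ?_⟩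
        ext i
        fin_cases i <;> simp <;> field_simp <;> linarith
  rcases hc.wbtw_or_wbtw_or_wbtw with h1 | h1 | h1
  · exact Or.inr (Or.inr (mem_segment_iff_wbtw.2 h1))
  · exact Or.inl (mem_segment_iff_wbtw.2 h1.symm)
  · exact Or.inr (Or.inl (mem_segment_iff_wbtw.2 h1.symm))

theorem inTriangle_of_mem_segment {u v x y : EuclideanSpace ℝ (Fin 2)} (h : y ∈ segment ℝ u v) :
    InTriangle u v x y := by
  obtain ⟨s, t, hs, ht, hst, rfl⟩ := h
  exact ⟨0, s, t, le_rfl, hs, ht, by linarith, by simp⟩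

/-- Two open segments from the same point that meet are nested. -/
theorem mem_segment_of_openSegment_inter {a b d : EuclideanSpace ℝ (Fin 2)}
    (h : (openSegment ℝ a b ∩ openSegment ℝ a d).Nonempty) :
    b ∈ segment ℝ a d ∨ d ∈ segment ℝ a b := by
  obtain ⟨x, ⟨s, t, hs, ht, hst, rfl⟩, ⟨s', t', hs', ht', hst', hx⟩⟩ := h
  have hs2 : s = 1 - t := by linarith
  have hs2' : s' = 1 - t' := by linarith
  subst hs2 hs2'
  have hx' : ∀ i, t' * (d i - a i) = t * (b i - a i) := fun i => by
    have := congrArg (fun z : EuclideanSpace ℝ (Fin 2) => z i) hx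
    simp only [PiLp.add_apply, PiLp.smul_apply, smul_eq_mul] at this
    linarith
  rcases le_total t' t with h | h
  · left
    refine ⟨1 - t' / t, t' / t, ?_, by positivity, by ring, ?_⟩
    · rw [sub_nonneg, div_le_one ht]; exact h
    · ext i
      simp only [PiLp.add_apply, PiLp.smul_apply, smul_eq_mul]
      have := hx' i
      field_simp; linarith
  · right
    refine ⟨1 - t / t', t / t', ?_, by positivity, by ring, ?_⟩
    · rw [sub_nonneg, div_le_one ht']; exact h
    · ext i
      simp only [PiLp.add_apply, PiLp.smul_apply, smul_eq_mul]
      have := hx' i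
      field_simp; linarith

theorem SegmentsMeet.orient_mul_neg_or_mem {a b c d : EuclideanSpace ℝ (Fin 2)}
    (h : SegmentsMeet a b c d) (hd : orient a b d ≠ 0) :
    orient a b c * orient a b d < 0 ∨ c ∈ segment ℝ a b := by
  obtain ⟨q, hq, hq'⟩ := h
  obtain ⟨s, t, hs, ht, hst, h0⟩ := id hq'
  have hz := orient_eq_zero_of_mem_segment hq
  rw [← h0, orient_combo _ _ _ _ hst] at hz
  rcases ht.eq_or_lt with rfl | ht
  · right
    obtain rfl : s = 1 := by linarith
    simp at h0
    rwa [h0]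
  · left
    have hsq : 0 < orient a b d ^ 2 := by positivity
    rcases hs.eq_or_lt with rfl | hs
    · simp_all
    · by_contra hh
      push Not at hh
      have : s * (orient a b c * orient a b d) + t * orient a b d ^ 2 = 0 := by
        linear_combination orient a b d * hz
      nlinarith [mul_nonneg hs.le hh, mul_pos ht hsq]

/-! ### Unit disk complexes and crossing paths -/

/-- A unit disk realization of a `K₄`-free graph all of whose edges have degree at least two. -/
structure IsUnitDiskComplex {V : Type*} (G : SimpleGraph V)
    (f : V → EuclideanSpace ℝ (Fin 2)) : Prop where
  injective : Function.Injective f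
  adj_iff : ∀ u v : V, u ≠ v → (G.Adj u v ↔ dist (f u) (f v) < 1)
  cliqueFree : ∀ a b c d : V, G.Adj a b → G.Adj a c → G.Adj a d → G.Adj b c → G.Adj b d →
    G.Adj c d → False
  exists_ne : ∀ u v w : V, G.Adj u v → ∃ x, x ≠ w ∧ G.Adj x u ∧ G.Adj x v

/-- Two crossing edges `p₀p₂` and `p₁p₃` of a graph such that `p₀`, `p₃` is the only pair of
endpoints that is not adjacent. -/
structure IsCrossingPath {V : Type*} (G : SimpleGraph V) (f : V → EuclideanSpace ℝ (Fin 2))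
    (p₀ p₁ p₂ p₃ : V) : Prop where
  adj01 : G.Adj p₀ p₁
  adj12 : G.Adj p₁ p₂
  adj23 : G.Adj p₂ p₃
  adj02 : G.Adj p₀ p₂
  adj13 : G.Adj p₁ p₃
  not_adj : ¬ G.Adj p₀ p₃
  ne : p₀ ≠ p₃
  meet : SegmentsMeet (f p₀) (f p₂) (f p₁) (f p₃)

section

variable {V : Type*} {G : SimpleGraph V} {f : V → EuclideanSpace ℝ (Fin 2)}

namespace IsUnitDiskComplex

theorem dist_lt (h : IsUnitDiskComplex G f) {u v : V} (huv : G.Adj u v) :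
    dist (f u) (f v) < 1 := (h.adj_iff u v huv.ne).1 huv

theorem le_dist (h : IsUnitDiskComplex G f) {u v : V} (hne : u ≠ v) (huv : ¬ G.Adj u v) :
    1 ≤ dist (f u) (f v) := by
  by_contra! hh
  exact huv ((h.adj_iff u v hne).2 hh)

theorem not_inTriangle (h : IsUnitDiskComplex G f) {u v x y : V} (huv : G.Adj u v)
    (hux : G.Adj u x) (hvx : G.Adj v x) (hyu : y ≠ u) (hyv : y ≠ v) (hyx : y ≠ x) :
    ¬ InTriangle (f u) (f v) (f x) (f y) := by
  intro hy
  refine h.cliqueFree u v x y huv hux ?_ hvx ?_ ?_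
  · rw [h.adj_iff _ _ hyu.symm]
    exact hy.dist_lt (by simp) (h.dist_lt huv) (h.dist_lt hux)
  · rw [h.adj_iff _ _ hyv.symm]
    exact hy.dist_lt (h.dist_lt huv.symm) (by simp) (h.dist_lt hvx)
  · rw [h.adj_iff _ _ hyx.symm]
    exact hy.dist_lt (h.dist_lt hux.symm) (h.dist_lt hvx.symm) (by simp)

/-- The edge is a side of a triangle that avoids `y` as a corner, and such triangles are empty. -/
theorem not_mem_segment (h : IsUnitDiskComplex G f) {u v y : V} (huv : G.Adj u v)
    (hyu : y ≠ u) (hyv : y ≠ v) : f y ∉ segment ℝ (f u) (f v) := by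
  intro hy
  obtain ⟨x, hxy, hxu, hxv⟩ := h.exists_ne u v y huv
  exact h.not_inTriangle huv hxu.symm hxv.symm hyu hyv hxy.symm (inTriangle_of_mem_segment hy)

theorem orient_ne_zero (h : IsUnitDiskComplex G f) {u v x : V} (huv : G.Adj u v)
    (hux : G.Adj u x) (hvx : G.Adj v x) : orient (f u) (f v) (f x) ≠ 0 := by
  intro h0
  rcases mem_segment_of_orient_eq_zero (h.injective.ne huv.ne) h0 with h1 | h1 | h1
  · exact h.not_mem_segment huv hux.ne' hvx.ne' h1
  · exact h.not_mem_segment hvx huv.ne hux.ne h1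
  · exact h.not_mem_segment hux huv.ne' hvx.ne h1

theorem orient_mul_neg (h : IsUnitDiskComplex G f) {a b c d : V} (hab : G.Adj a b)
    (had : G.Adj a d) (hbd : G.Adj b d) (hca : c ≠ a) (hcb : c ≠ b)
    (hm : SegmentsMeet (f a) (f b) (f c) (f d)) :
    orient (f a) (f b) (f c) * orient (f a) (f b) (f d) < 0 :=
  (hm.orient_mul_neg_or_mem (h.orient_ne_zero hab had hbd)).resolve_right
    (h.not_mem_segment hab hca hcb)

/-- Two common neighbours of `u`, `v` on the same side of the edge `u v`. -/
theorem same_side (h : IsUnitDiskComplex G f) {u v x y : V} (huv : G.Adj u v)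
    (hxu : G.Adj x u) (hxv : G.Adj x v) (hyu : G.Adj y u) (hyv : G.Adj y v) (hxy : x ≠ y)
    (hs : 0 < orient (f u) (f v) (f x) * orient (f u) (f v) (f y)) :
    IsCrossingPath G f x u v y ∨ IsCrossingPath G f y u v x := by
  have hn : ¬ G.Adj x y := fun hxy' => h.cliqueFree u v x y huv hxu.symm hyu.symm hxv.symm
    hyv.symm hxy'
  rcases _root_.same_side hs with h1 | h1 | h1 | h1
  · exact absurd h1 (h.not_inTriangle huv hxu.symm hxv.symm hyu.ne hyv.ne hxy.symm)
  · exact absurd h1 (h.not_inTriangle huv hyu.symm hyv.symm hxu.ne hxv.ne hxy)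
  · exact Or.inl ⟨hxu, huv, hyv.symm, hxv, hyu.symm, hn, hxy, h1⟩
  · exact Or.inr ⟨hyu, huv, hxv.symm, hyv, hxu.symm, fun h' => hn h'.symm, hxy.symm, h1⟩

/-- A vertex of a crossing that is adjacent to the three others is not the only such vertex. -/
theorem adj_or_adj (h : IsUnitDiskComplex G f) {a b c d : V} (hab : G.Adj a b) (hac : G.Adj a c)
    (had : G.Adj a d) (hcd : G.Adj c d) (hbc : b ≠ c) (hbd : b ≠ d)
    (hm : SegmentsMeet (f a) (f b) (f c) (f d)) : G.Adj b c ∨ G.Adj b d := by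
  by_contra! hn
  obtain ⟨hnc, hnd⟩ := hn
  obtain ⟨e, hea, hec, hed⟩ := h.exists_ne c d a hcd
  have hnae : ¬ G.Adj a e := fun hae => h.cliqueFree a c d e hac had hae hcd hec.symm hed.symm
  have hbe : b ≠ e := by rintro rfl; exact hnc hec
  have lc := h.le_dist hbc hnc
  have ld := h.le_dist hbd hnd
  have le := h.le_dist hea.symm hnae
  have lab := h.dist_lt hab
  have lce := h.dist_lt hec.symm
  have lde := h.dist_lt hed.symm
  have i1 := hm.dist_le
  have i2 := hm.swap_right.dist_le
  have oa := h.orient_ne_zero hcd hac.symm had.symm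
  have oe := h.orient_ne_zero hcd hec.symm hed.symm
  -- If `e` lies across `c d` from `a`, the segment `a b` leaves the triangle `c d e` through a
  -- side, and that crossing sets two distances at least 1 against two edges. If `e` lies on the
  -- side of `a`, then `i1` and `i2` make `a c` and `a d` shorter than `c d`, and the crossing near
  -- `c d` forces `a e` below 1.
  rcases lt_or_gt_of_ne (mul_ne_zero oa oe) with ho | ho
  · rcases hm.pasch ho with h1 | h1 | h1
    · exact h.not_inTriangle hcd hec.symm hed.symm hbc hbd hbe h1
    · have := h1.swap_right.dist_le
      grind [dist_comm]
    · have := h1.swap_right.dist_le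
      grind [dist_comm]
  · rcases h.same_side hcd hac had hec hed hea.symm ho with h1 | h1
    · have := h1.meet.swap_right.dist_le
      grind [dist_comm]
    · have := h1.meet.swap_right.dist_le
      grind [dist_comm]

end IsUnitDiskComplex

namespace IsCrossingPath

variable {p₀ p₁ p₂ p₃ p₄ p₅ : V}

theorem reverse (hq : IsCrossingPath G f p₀ p₁ p₂ p₃) : IsCrossingPath G f p₃ p₂ p₁ p₀ :=
  ⟨hq.adj23.symm, hq.adj12.symm, hq.adj01.symm, hq.adj13.symm, hq.adj02.symm,
    fun h => hq.not_adj h.symm, hq.ne.symm, hq.meet.swap_left.swap_right.symm⟩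

theorem mid_lt_left (hq : IsCrossingPath G f p₀ p₁ p₂ p₃) (h : IsUnitDiskComplex G f) :
    dist (f p₁) (f p₂) < dist (f p₀) (f p₂) := by
  have h1 := hq.meet.swap_right.dist_le
  have h2 := h.le_dist hq.ne hq.not_adj
  have h3 := h.dist_lt hq.adj13
  grind [dist_comm]

theorem mid_lt_right (hq : IsCrossingPath G f p₀ p₁ p₂ p₃) (h : IsUnitDiskComplex G f) :
    dist (f p₁) (f p₂) < dist (f p₁) (f p₃) := by
  have := hq.reverse.mid_lt_left h
  grind [dist_comm]

/-- If `p₄` lies across `p₀p₂` from `p₁`, then `p₁p₃` can leave the triangle `p₀p₂p₄` only through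
`p₂p₄`. If it lies on the same side, one of the two possible crossings contradicts `mid_lt_left` and
the other yields the length comparison. -/
theorem meet_or_lt (hq : IsCrossingPath G f p₀ p₁ p₂ p₃) (h : IsUnitDiskComplex G f)
    (h41 : p₄ ≠ p₁) (h40 : G.Adj p₄ p₀) (h42 : G.Adj p₄ p₂) :
    SegmentsMeet (f p₁) (f p₃) (f p₂) (f p₄) ∨ dist (f p₀) (f p₂) < dist (f p₀) (f p₁) := by
  have hn : ¬ G.Adj p₄ p₁ := fun h' =>
    h.cliqueFree p₀ p₁ p₂ p₄ hq.adj01 hq.adj02 h40.symm hq.adj12 h'.symm h42.symm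
  have l14 := h.le_dist h41 hn
  have l03 := h.le_dist hq.ne hq.not_adj
  have oa := h.orient_ne_zero hq.adj02 hq.adj01 hq.adj12.symm
  have oe := h.orient_ne_zero hq.adj02 h40.symm h42.symm
  have l24 := h.dist_lt h42
  have l04 := h.dist_lt h40
  have l13 := h.dist_lt hq.adj13
  have lm := hq.mid_lt_left h
  rcases lt_or_gt_of_ne (mul_ne_zero oa oe) with ho | ho
  · rcases hq.meet.symm.pasch ho with h1 | h1 | h1
    · refine absurd h1 (h.not_inTriangle hq.adj02 h40.symm h42.symm hq.ne.symm hq.adj23.ne' ?_)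
      rintro rfl
      exact hq.not_adj h40.symm
    · have := h1.swap_right.dist_le
      grind [dist_comm]
    · exact Or.inl h1
  · rcases h.same_side hq.adj02 hq.adj01.symm hq.adj12 h40 h42 h41.symm ho with h1 | h1
    · have := h1.meet.swap_right.dist_le
      grind [dist_comm]
    · have := h1.meet.swap_right.dist_le
      grind [dist_comm]

theorem lt_of_meet (hq : IsCrossingPath G f p₀ p₁ p₂ p₃) (h : IsUnitDiskComplex G f)
    (h41 : p₄ ≠ p₁) (h40 : G.Adj p₄ p₀) (h42 : G.Adj p₄ p₂)
    (hm : SegmentsMeet (f p₁) (f p₃) (f p₂) (f p₄)) :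
    dist (f p₂) (f p₃) < dist (f p₁) (f p₃) := by
  have hn : ¬ G.Adj p₄ p₁ := fun h' =>
    h.cliqueFree p₀ p₁ p₂ p₄ hq.adj01 hq.adj02 h40.symm hq.adj12 h'.symm h42.symm
  have l14 := h.le_dist h41 hn
  have l24 := h.dist_lt h42
  have := hm.swap_right.dist_le
  grind [dist_comm]

theorem extend_aux (hq : IsCrossingPath G f p₀ p₁ p₂ p₃) (h : IsUnitDiskComplex G f)
    (h41 : p₄ ≠ p₁) (h40 : G.Adj p₄ p₀) (h42 : G.Adj p₄ p₂)
    (h52 : p₅ ≠ p₂) (h51 : G.Adj p₅ p₁) (h53 : G.Adj p₅ p₃) :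
    IsCrossingPath G f p₁ p₂ p₃ p₄ := by
  have hn : ¬ G.Adj p₄ p₁ := fun h' =>
    h.cliqueFree p₀ p₁ p₂ p₄ hq.adj01 hq.adj02 h40.symm hq.adj12 h'.symm h42.symm
  have hm : SegmentsMeet (f p₁) (f p₃) (f p₂) (f p₄) := by
    -- If `p₀p₂` is shorter than `p₀p₁`, the given crossing makes `p₂p₃` shorter than `p₁p₃`. The
    -- mirrored dichotomy, with `p₅` in place of `p₄`, would reverse one of these two comparisons.
    refine (hq.meet_or_lt h h41 h40 h42).resolve_right fun h1 => ?_
    have hs := hq.meet.dist_le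
    rcases hq.reverse.meet_or_lt h h52 h53 h51 with h2 | h2
    · have := hq.reverse.lt_of_meet h h52 h53 h51 h2
      grind [dist_comm]
    · grind [dist_comm]
  have h43 : p₃ ≠ p₄ := by rintro rfl; exact hq.not_adj h40.symm
  refine ⟨hq.adj12, hq.adj23, ?_, hq.adj13, h42.symm, fun h' => hn h'.symm, h41.symm, hm⟩
  rcases h.adj_or_adj h42.symm hq.adj12.symm hq.adj23 hq.adj13 h41 h43.symm hm.symm with h' | h'
  · exact absurd h' hn
  · exact h'.symm

end IsCrossingPath

/-! ### Closing a crossing path to a hexagon; rigidity -/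

/-- Six vertices in cyclic order such that any four consecutive ones form a crossing path. -/
def IsHexagon {V : Type*} (G : SimpleGraph V) (f : V → EuclideanSpace ℝ (Fin 2))
    (p : Fin 6 → V) : Prop :=
  ∀ i : Fin 6, IsCrossingPath G f (p i) (p (i + 1)) (p (i + 2)) (p (i + 3))

namespace IsCrossingPath

variable {p₀ p₁ p₂ p₃ p₄ p₅ : V}

theorem isHexagon (hq : IsCrossingPath G f p₀ p₁ p₂ p₃) (h : IsUnitDiskComplex G f)
    (h41 : p₄ ≠ p₁) (h40 : G.Adj p₄ p₀) (h42 : G.Adj p₄ p₂)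
    (h52 : p₅ ≠ p₂) (h51 : G.Adj p₅ p₁) (h53 : G.Adj p₅ p₃) :
    IsHexagon G f ![p₀, p₁, p₂, p₃, p₄, p₅] := by
  have q1 := hq.extend_aux h h41 h40 h42 h52 h51 h53
  have q2 := q1.extend_aux h h52 h51 h53 hq.ne hq.adj02 h40.symm
  have q3 := q2.extend_aux h hq.ne hq.adj02 h40.symm h41.symm hq.adj13 h51.symm
  have q4 := q3.extend_aux h h41.symm hq.adj13 h51.symm h52.symm h42.symm hq.adj02.symm
  have q5 := q4.extend_aux h h52.symm h42.symm hq.adj02.symm hq.ne.symm h53.symm hq.adj13.symm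
  intro i
  fin_cases i
  · exact hq
  · exact q1
  · exact q2
  · exact q3
  · exact q4
  · exact q5

theorem exists_isHexagon (hq : IsCrossingPath G f p₀ p₁ p₂ p₃) (h : IsUnitDiskComplex G f) :
    ∃ p : Fin 6 → V, IsHexagon G f p ∧ p 0 = p₀ ∧ p 1 = p₁ ∧ p 2 = p₂ ∧ p 3 = p₃ := by
  obtain ⟨p₄, h41, h40, h42⟩ := h.exists_ne p₀ p₂ p₁ hq.adj02
  obtain ⟨p₅, h52, h51, h53⟩ := h.exists_ne p₁ p₃ p₂ hq.adj13
  exact ⟨_, hq.isHexagon h h41 h40 h42 h52 h51 h53, rfl, rfl, rfl, rfl⟩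

end IsCrossingPath

namespace IsHexagon

variable {p : Fin 6 → V}

theorem rotate (hp : IsHexagon G f p) (k : Fin 6) : IsHexagon G f (fun j => p (j + k)) := by
  intro i
  simpa only [add_right_comm] using hp (i + k)

theorem reverse (hp : IsHexagon G f p) (k : Fin 6) : IsHexagon G f (fun j => p (k - j)) := by
  intro i
  have e1 : ∀ i k : Fin 6, k - i = k - (i + 3) + 3 := by decide
  have e2 : ∀ i k : Fin 6, k - (i + 1) = k - (i + 3) + 2 := by decide
  have e3 : ∀ i k : Fin 6, k - (i + 2) = k - (i + 3) + 1 := by decide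
  dsimp only
  rw [e1 i, e2 i, e3 i]
  exact (hp (k - (i + 3))).reverse

theorem range_rotate (p : Fin 6 → V) (k : Fin 6) :
    Set.range (fun j => p (j + k)) = Set.range p :=
  (Equiv.addRight k).surjective.range_comp p

theorem range_reverse (p : Fin 6 → V) (k : Fin 6) :
    Set.range (fun j => p (k - j)) = Set.range p :=
  (Equiv.subLeft k).surjective.range_comp p

theorem adj_iff (hp : IsHexagon G f p) (i j : Fin 6) :
    G.Adj (p i) (p j) ↔ j ≠ i ∧ j ≠ i + 3 := by
  have e : ∀ i j : Fin 6, j = i ∨ j = i + 1 ∨ j = i + 2 ∨ j = i + 3 ∨ i = j + 1 ∨ i = j + 2 := by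
    decide
  have n1 : ∀ i : Fin 6, i + 1 ≠ i ∧ i + 1 ≠ i + 3 := by decide
  have n2 : ∀ i : Fin 6, i + 2 ≠ i ∧ i + 2 ≠ i + 3 := by decide
  have n3 : ∀ j : Fin 6, j ≠ j + 1 ∧ j ≠ j + 1 + 3 := by decide
  have n4 : ∀ j : Fin 6, j ≠ j + 2 ∧ j ≠ j + 2 + 3 := by decide
  rcases e i j with rfl | rfl | rfl | rfl | rfl | rfl
  · simp
  · exact iff_of_true (hp i).adj01 (n1 i)
  · exact iff_of_true (hp i).adj02 (n2 i)
  · exact iff_of_false (hp i).not_adj (by simp)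
  · exact iff_of_true (hp j).adj01.symm (n3 j)
  · exact iff_of_true (hp j).adj02.symm (n4 j)

theorem injective (hp : IsHexagon G f p) : Function.Injective p := by
  intro i j hij
  by_contra hne
  by_cases h3 : j = i + 3
  · subst h3
    exact (hp i).ne hij
  · have := (hp.adj_iff i j).2 ⟨Ne.symm hne, h3⟩
    exact this.ne hij

theorem side_lt (hp : IsHexagon G f p) (h : IsUnitDiskComplex G f) (i : Fin 6) :
    dist (f (p i)) (f (p (i + 1))) < dist (f (p i)) (f (p (i + 2))) := by
  have e : ∀ i : Fin 6, i - 1 + 1 = i ∧ i - 1 + 2 = i + 1 ∧ i - 1 + 3 = i + 2 := by decide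
  have := (hp (i - 1)).mid_lt_right h
  rwa [(e i).1, (e i).2.1, (e i).2.2] at this

theorem side_lt' (hp : IsHexagon G f p) (h : IsUnitDiskComplex G f) (i : Fin 6) :
    dist (f (p (i + 1))) (f (p (i + 2))) < dist (f (p i)) (f (p (i + 2))) :=
  (hp i).mid_lt_left h

end IsHexagon

namespace IsCrossingPath

variable {p₀ p₁ p₂ p₃ : V}

/-- Not visible from the four vertices alone: in the hexagon completing the path, `p₀p₁` is the
middle of the preceding crossing path. -/
theorem fst_lt (hq : IsCrossingPath G f p₀ p₁ p₂ p₃) (h : IsUnitDiskComplex G f) :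
    dist (f p₀) (f p₁) < dist (f p₀) (f p₂) := by
  obtain ⟨p, hp, rfl, rfl, rfl, rfl⟩ := hq.exists_isHexagon h
  exact hp.side_lt h 0

theorem last_lt (hq : IsCrossingPath G f p₀ p₁ p₂ p₃) (h : IsUnitDiskComplex G f) :
    dist (f p₂) (f p₃) < dist (f p₁) (f p₃) := by
  have := hq.reverse.fst_lt h
  grind [dist_comm]

theorem orient_mul_neg (hq : IsCrossingPath G f p₀ p₁ p₂ p₃) (h : IsUnitDiskComplex G f) :
    orient (f p₁) (f p₃) (f p₀) * orient (f p₁) (f p₃) (f p₂) < 0 :=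
  h.orient_mul_neg hq.adj13 hq.adj12 hq.adj23.symm hq.adj01.ne hq.ne hq.meet.symm

/-- The common point of `p₀p₂` and `p₁p₃` is a positive multiple as far from the line `p₁p₂` as
either of `p₀`, `p₃`, on the same side. -/
theorem orient_mid_mul_pos (hq : IsCrossingPath G f p₀ p₁ p₂ p₃) (h : IsUnitDiskComplex G f) :
    0 < orient (f p₁) (f p₂) (f p₀) * orient (f p₁) (f p₂) (f p₃) := by
  obtain ⟨x, ⟨s, t, hs, ht, hst, h1⟩, ⟨s', t', hs', ht', hst', h2⟩⟩ := hq.meet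
  have o1 := orient_combo (f p₁) (f p₂) (f p₀) (f p₂) hst
  have o2 := orient_combo (f p₁) (f p₂) (f p₁) (f p₃) hst'
  rw [h1, orient_right_self] at o1
  rw [h2, orient_left_self] at o2
  have n0 := h.orient_ne_zero hq.adj12 hq.adj01.symm hq.adj02.symm
  have n3 := h.orient_ne_zero hq.adj12 hq.adj13 hq.adj23
  have hs0 : 0 < s := by
    refine hs.lt_of_ne ?_
    rintro rfl
    obtain rfl : t = 1 := by linarith
    simp only [zero_smul, one_smul, zero_add] at h1
    rw [← h1] at h2
    exact h.not_mem_segment hq.adj13 hq.adj12.ne' hq.adj23.ne ⟨s', t', hs', ht', hst', h2⟩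
  have key : s * orient (f p₁) (f p₂) (f p₀) = t' * orient (f p₁) (f p₂) (f p₃) := by linarith
  have ht0 : 0 < t' := by
    refine ht'.lt_of_ne ?_
    rintro rfl
    rw [zero_mul] at key
    exact (mul_ne_zero hs0.ne' n0) key
  have : 0 < (s * orient (f p₁) (f p₂) (f p₀)) ^ 2 := by positivity
  have h3 : (s * orient (f p₁) (f p₂) (f p₀)) ^ 2 =
      (s * t') * (orient (f p₁) (f p₂) (f p₀) * orient (f p₁) (f p₂) (f p₃)) := by
    rw [sq]; nth_rw 2 [key]; ring
  rw [h3] at this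
  exact (pos_iff_pos_of_mul_pos this).1 (by positivity)

/-- A diagonal of a crossing path has only one common neighbour besides the vertex in between. -/
theorem eq_of_adj_diagonal {p₄ p₄' : V} (hq : IsCrossingPath G f p₀ p₁ p₂ p₃)
    (h : IsUnitDiskComplex G f)
    (h41 : p₄ ≠ p₁) (h40 : G.Adj p₄ p₀) (h42 : G.Adj p₄ p₂)
    (h41' : p₄' ≠ p₁) (h40' : G.Adj p₄' p₀) (h42' : G.Adj p₄' p₂) : p₄ = p₄' := by
  by_contra hne
  obtain ⟨p₅, h52, h51, h53⟩ := h.exists_ne p₁ p₃ p₂ hq.adj13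
  have hp := hq.isHexagon h h41 h40 h42 h52 h51 h53
  have hp' := hq.isHexagon h h41' h40' h42' h52 h51 h53
  have q2 : IsCrossingPath G f p₂ p₃ p₄ p₅ := hp 2
  have q2' : IsCrossingPath G f p₂ p₃ p₄' p₅ := hp' 2
  have q3 : IsCrossingPath G f p₃ p₄ p₅ p₀ := hp 3
  have q3' : IsCrossingPath G f p₃ p₄' p₅ p₀ := hp' 3
  have o := q2.orient_mul_neg h
  have o' := q2'.orient_mul_neg h
  -- Both candidates lie across `p₃p₅` from `p₂`. Being on one side they would make `p₃p₅` the
  -- middle of a crossing path, hence short, whereas it is a short diagonal of both hexagons and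
  -- exceeds their sides at `p₅`.
  have ho : 0 < orient (f p₃) (f p₅) (f p₄) * orient (f p₃) (f p₅) (f p₄') := by
    rcases lt_or_ge (orient (f p₃) (f p₅) (f p₂)) 0 with h0 | h0
    · exact mul_pos (by nlinarith) (by nlinarith)
    · exact mul_pos_of_neg_of_neg (by nlinarith) (by nlinarith)
  have l1 := q2.last_lt h
  have l2 := q2'.last_lt h
  have l3 := q3.fst_lt h
  have l4 := q3'.fst_lt h
  rcases h.same_side q2.adj13 q3.adj01.symm q2.adj23 q3'.adj01.symm q2'.adj23 hne ho with q | q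
  · have := q.mid_lt_left h
    grind [dist_comm]
  · have := q.mid_lt_left h
    grind [dist_comm]

end IsCrossingPath

/-! ### Common neighbours on one side of an edge; the shape of a crossing -/

namespace IsUnitDiskComplex

/-- There are at most two common neighbours on the same side of an edge. -/
theorem eq_of_same_side (h : IsUnitDiskComplex G f) {u v x y z : V} (huv : G.Adj u v)
    (hxu : G.Adj x u) (hxv : G.Adj x v) (hyu : G.Adj y u) (hyv : G.Adj y v)
    (hzu : G.Adj z u) (hzv : G.Adj z v) (hxy : x ≠ y) (hxz : x ≠ z)
    (hy : 0 < orient (f u) (f v) (f x) * orient (f u) (f v) (f y))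
    (hz : 0 < orient (f u) (f v) (f x) * orient (f u) (f v) (f z)) : y = z := by
  by_contra hyz
  have hs : 0 < orient (f u) (f v) (f y) * orient (f u) (f v) (f z) := by
    rcases lt_or_ge (orient (f u) (f v) (f x)) 0 with h0 | h0
    · exact mul_pos_of_neg_of_neg (by nlinarith) (by nlinarith)
    · exact mul_pos (by nlinarith) (by nlinarith)
  -- Of two common neighbours on the same side, one is closer to `u` and the other closer to `v`;
  -- three vertices cannot differ pairwise in this respect.
  have key : ∀ a b : V, IsCrossingPath G f a u v b →
      dist (f a) (f u) < dist (f a) (f v) ∧ dist (f b) (f v) < dist (f b) (f u) := by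
    intro a b q
    refine ⟨q.fst_lt h, ?_⟩
    have := q.last_lt h
    grind [dist_comm]
  rcases h.same_side huv hxu hxv hyu hyv hxy hy with q1 | q1 <;>
  rcases h.same_side huv hxu hxv hzu hzv hxz hz with q2 | q2 <;>
  rcases h.same_side huv hyu hyv hzu hzv hyz hs with q3 | q3 <;>
  · have := key _ _ q1
    have := key _ _ q2
    have := key _ _ q3
    grind

/-- The labelling of a crossing by a crossing path. -/
theorem exists_isCrossingPath (h : IsUnitDiskComplex G f) {a b c d : V} (hab : G.Adj a b)
    (hcd : G.Adj c d) (hac : a ≠ c) (had : a ≠ d) (hbc : b ≠ c) (hbd : b ≠ d)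
    (hm : SegmentsMeet (f a) (f b) (f c) (f d)) :
    IsCrossingPath G f a c b d ∨ IsCrossingPath G f a d b c ∨ IsCrossingPath G f b c a d ∨
      IsCrossingPath G f b d a c := by
  have i1 := hm.dist_le
  have i2 := hm.swap_right.dist_le
  have lab := h.dist_lt hab
  have lcd := h.dist_lt hcd
  have nac := h.le_dist hac
  have nad := h.le_dist had
  have nbc := h.le_dist hbc
  have nbd := h.le_dist hbd
  have k4 := h.cliqueFree a b c d hab
  have j1 : G.Adj a c ∨ G.Adj b d := by
    by_contra! hh
    have := nac hh.1
    have := nbd hh.2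
    linarith
  have j2 : G.Adj a d ∨ G.Adj b c := by
    by_contra! hh
    have := nad hh.1
    have := nbc hh.2
    grind [dist_comm]
  have ja := fun x y => h.adj_or_adj hab x y hcd hbc hbd hm
  have jb := fun x y => h.adj_or_adj hab.symm x y hcd hac had hm.swap_left
  have jc := fun x y => h.adj_or_adj hcd x y hab had.symm hbd.symm hm.symm
  have jd := fun x y => h.adj_or_adj hcd.symm x y hab hac.symm hbc.symm hm.symm.swap_left
  rw [G.adj_comm c, G.adj_comm c, G.adj_comm d, G.adj_comm d] at jc
  rw [G.adj_comm c, G.adj_comm c, G.adj_comm d, G.adj_comm d] at jd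
  have key : (G.Adj a c ∧ G.Adj b c ∧ G.Adj b d ∧ ¬ G.Adj a d) ∨
      (G.Adj a d ∧ G.Adj b d ∧ G.Adj b c ∧ ¬ G.Adj a c) ∨
      (G.Adj b c ∧ G.Adj a c ∧ G.Adj a d ∧ ¬ G.Adj b d) ∨
      (G.Adj b d ∧ G.Adj a d ∧ G.Adj a c ∧ ¬ G.Adj b c) := by
    grind
  rcases key with ⟨h1, h2, h3, h4⟩ | ⟨h1, h2, h3, h4⟩ | ⟨h1, h2, h3, h4⟩ | ⟨h1, h2, h3, h4⟩
  · exact Or.inl ⟨h1, h2.symm, h3, hab, hcd, h4, had, hm⟩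
  · exact Or.inr (Or.inl ⟨h1, h2.symm, h3, hab, hcd.symm, h4, hac, hm.swap_right⟩)
  · exact Or.inr (Or.inr (Or.inl ⟨h1, h2.symm, h3, hab.symm, hcd, h4, hbd, hm.swap_left⟩))
  · exact Or.inr (Or.inr (Or.inr ⟨h1, h2.symm, h3, hab.symm, hcd.symm, h4, hbc,
      hm.swap_left.swap_right⟩))

end IsUnitDiskComplex

/-! ### Octahedra and their hexagons -/

/-- The parts become the antipodal pairs `{i, i + 3}`, which matches `IsHexagon.adj_iff` and makes
the combinatorics decidable over `Fin 6`. -/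
theorem isInducedK222_iff {V : Type*} {G : SimpleGraph V} {S : Finset V} :
    IsInducedK222 G S ↔ ∃ p : Fin 6 → V, Function.Injective p ∧ (S : Set V) = Set.range p ∧
      ∀ i j, G.Adj (p i) (p j) ↔ j ≠ i ∧ j ≠ i + 3 := by
  let e₀ : Fin 6 → Σ _ : Fin 3, Fin 2 := ![⟨0, 0⟩, ⟨1, 0⟩, ⟨2, 0⟩, ⟨0, 1⟩, ⟨1, 1⟩, ⟨2, 1⟩]
  have he₀ : Function.Bijective e₀ := by decide
  let e : Fin 6 ≃ Σ _ : Fin 3, Fin 2 := Equiv.ofBijective e₀ he₀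
  have hadj : ∀ i j, K222.Adj (e i) (e j) ↔ j ≠ i ∧ j ≠ i + 3 := by
    have : ∀ i j, (e₀ i).1 ≠ (e₀ j).1 ↔ j ≠ i ∧ j ≠ i + 3 := by decide
    exact this
  constructor
  · rintro ⟨φ⟩
    refine ⟨fun i => (φ.symm (e i) : (S : Set V)), ?_, ?_, ?_⟩
    · exact Subtype.val_injective.comp (φ.symm.injective.comp e.injective)
    · ext v
      constructor
      · intro hv
        exact ⟨e.symm (φ ⟨v, hv⟩), by simp⟩
      · rintro ⟨i, rfl⟩
        exact (φ.symm (e i)).2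
    · intro i j
      rw [← hadj, ← φ.symm.map_adj_iff]
      rfl
  · rintro ⟨p, hinj, hS, hp⟩
    have hmem : ∀ i, p i ∈ (S : Set V) := fun i => hS ▸ Set.mem_range_self i
    let g : Fin 6 → (S : Set V) := fun i => ⟨p i, hmem i⟩
    have hg : Function.Bijective g := by
      refine ⟨fun i j hij => hinj (congrArg Subtype.val hij), ?_⟩
      rintro ⟨v, hv⟩
      obtain ⟨i, rfl⟩ := hS ▸ hv
      exact ⟨i, rfl⟩
    let ψ : K222 ≃g G.induce (S : Set V) :=
      { toEquiv := e.symm.trans (Equiv.ofBijective g hg)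
        map_rel_iff' := by
          intro a b
          obtain ⟨i, rfl⟩ := e.surjective a
          obtain ⟨j, rfl⟩ := e.surjective b
          rw [hadj]
          simpa using hp i j }
    exact ⟨ψ.symm⟩

theorem IsHexagon.isInducedK222 {p : Fin 6 → V} (hp : IsHexagon G f p) {S : Finset V}
    (hS : (S : Set V) = Set.range p) : IsInducedK222 G S :=
  isInducedK222_iff.2 ⟨p, hp.injective, hS, hp.adj_iff⟩

theorem IsHexagon.exists_isInducedK222 {p : Fin 6 → V} (hp : IsHexagon G f p) :
    ∃ S : Finset V, IsInducedK222 G S ∧ ∀ i, p i ∈ S := by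
  classical
  exact ⟨Finset.univ.image p, hp.isInducedK222 (by simp), by simp⟩

/-- A crossing path in an octahedron extends to a hexagon on its vertices. -/
theorem IsInducedK222.exists_isHexagon {S : Finset V} (hS : IsInducedK222 G S)
    (h : IsUnitDiskComplex G f) {p₀ p₁ p₂ p₃ : V} (hq : IsCrossingPath G f p₀ p₁ p₂ p₃)
    (h0 : p₀ ∈ S) (h1 : p₁ ∈ S) (h2 : p₂ ∈ S) (h3 : p₃ ∈ S) :
    ∃ p : Fin 6 → V, IsHexagon G f p ∧ (S : Set V) = Set.range p ∧
      p 0 = p₀ ∧ p 1 = p₁ ∧ p 2 = p₂ ∧ p 3 = p₃ := by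
  obtain ⟨q, hinj, hSq, hadj⟩ := isInducedK222_iff.1 hS
  have hm : ∀ v ∈ S, ∃ i, q i = v := fun v hv => by
    have : v ∈ (S : Set V) := hv
    rwa [hSq] at this
  obtain ⟨i, rfl⟩ := hm _ h0
  obtain ⟨j, rfl⟩ := hm _ h1
  obtain ⟨k, rfl⟩ := hm _ h2
  obtain ⟨l, rfl⟩ := hm _ h3
  have a01 := (hadj _ _).1 hq.adj01
  have a12 := (hadj _ _).1 hq.adj12
  have a02 := (hadj _ _).1 hq.adj02
  have a13 := (hadj _ _).1 hq.adj13
  have a03 := fun hh => hq.not_adj ((hadj i l).2 hh)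
  have nil : l ≠ i := fun hh => hq.ne (hh ▸ rfl)
  obtain rfl : l = i + 3 := by
    by_contra hl
    exact a03 ⟨nil, hl⟩
  have c1 : ∀ i j : Fin 6, (j ≠ i ∧ j ≠ i + 3) → (i ≠ j + 3 ∧ i ≠ j + 3 + 3) ∧
      (j ≠ i + 3 ∧ j ≠ i + 3 + 3) ∧ (i + 3 ≠ j + 3 ∧ i + 3 ≠ j + 3 + 3) := by decide
  have c2 : ∀ i j k : Fin 6, (j ≠ i ∧ j ≠ i + 3) → (k ≠ i ∧ k ≠ i + 3) → (k ≠ j ∧ k ≠ j + 3) →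
      ∀ m : Fin 6, m = i ∨ m = j ∨ m = k ∨ m = i + 3 ∨ m = j + 3 ∨ m = k + 3 := by decide
  have b1 := (c1 i j a01).1
  have b2 := (c1 j k a12).2.1
  have b3 := (c1 j k a12).1
  have b4 := (c1 i k a02).2.2
  have b5 := c2 i j k a01 a02 a12
  have n3 : ∀ i : Fin 6, i + 3 ≠ i := by decide
  -- The labels `j + 3` and `k + 3` are the antipodes of `p₁` and `p₂`, so the completion stays
  -- inside `S`.
  refine ⟨_, hq.isHexagon h (p₄ := q (j + 3)) (p₅ := q (k + 3)) (hinj.ne (n3 j))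
    ((hadj _ _).2 b1) ((hadj _ _).2 b2) (hinj.ne (n3 k)) ((hadj _ _).2 b3) ((hadj _ _).2 b4),
    ?_, rfl, rfl, rfl, rfl⟩
  rw [hSq]
  ext v
  simp only [Set.mem_range]
  constructor
  · rintro ⟨m, rfl⟩
    rcases b5 m with rfl | rfl | rfl | rfl | rfl | rfl
    · exact ⟨0, rfl⟩
    · exact ⟨1, rfl⟩
    · exact ⟨2, rfl⟩
    · exact ⟨3, rfl⟩
    · exact ⟨4, rfl⟩
    · exact ⟨5, rfl⟩
  · rintro ⟨m, rfl⟩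
    fin_cases m <;> exact ⟨_, rfl⟩

theorem IsCrossingPath.eq_of_isInducedK222 {p₀ p₁ p₂ p₃ : V}
    (hq : IsCrossingPath G f p₀ p₁ p₂ p₃) (h : IsUnitDiskComplex G f) {S T : Finset V}
    (hS : IsInducedK222 G S) (h0 : p₀ ∈ S) (h1 : p₁ ∈ S) (h2 : p₂ ∈ S) (h3 : p₃ ∈ S)
    (hT : IsInducedK222 G T) (h0' : p₀ ∈ T) (h1' : p₁ ∈ T) (h2' : p₂ ∈ T) (h3' : p₃ ∈ T) :
    S = T := by
  obtain ⟨p, hp, hSp, rfl, rfl, rfl, rfl⟩ := hS.exists_isHexagon h hq h0 h1 h2 h3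
  obtain ⟨p', hp', hTp, e0, e1, e2, e3⟩ := hT.exists_isHexagon h hq h0' h1' h2' h3'
  have adj := fun i j => (hp.adj_iff i j).2
  have adj' := fun i j => (hp'.adj_iff i j).2
  have e4 : p 4 = p' 4 :=
    hq.eq_of_adj_diagonal h (hp.injective.ne (by decide)) (adj _ _ (by decide))
      (adj _ _ (by decide)) (e1 ▸ hp'.injective.ne (by decide)) (e0 ▸ adj' _ _ (by decide))
      (e2 ▸ adj' _ _ (by decide))
  have e5 : p 5 = p' 5 :=
    hq.reverse.eq_of_adj_diagonal h (hp.injective.ne (by decide)) (adj _ _ (by decide))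
      (adj _ _ (by decide)) (e2 ▸ hp'.injective.ne (by decide)) (e3 ▸ adj' _ _ (by decide))
      (e1 ▸ adj' _ _ (by decide))
  have hpp : p = p' := by
    funext i
    fin_cases i
    exacts [e0.symm, e1.symm, e2.symm, e3.symm, e4, e5]
  rw [← Finset.coe_inj, hSp, hTp, hpp]

/-- At an extreme edge all common neighbours in `W` lie on one side, and two of them give a crossing
path. The subset `W` lets the argument serve both the whole graph and a single octahedron. -/
theorem IsUnitDiskComplex.exists_isCrossingPath_mem (h : IsUnitDiskComplex G f) (W : Finset V)
    (hW : ∃ u ∈ W, ∃ v ∈ W, G.Adj u v)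
    (hW2 : ∀ u ∈ W, ∀ v ∈ W, G.Adj u v → ∃ x ∈ W, ∃ y ∈ W, x ≠ y ∧ G.Adj x u ∧ G.Adj x v ∧
      G.Adj y u ∧ G.Adj y v) :
    ∃ p₀ ∈ W, ∃ p₁ ∈ W, ∃ p₂ ∈ W, ∃ p₃ ∈ W, IsCrossingPath G f p₀ p₁ p₂ p₃ := by
  classical
  obtain ⟨a, ha, b, hb, hab⟩ := hW
  obtain ⟨v, hv, hmax⟩ := (W.filter fun v => ∃ w ∈ W, G.Adj v w).exists_max_image
    (fun v => f v 0 ^ 2 + f v 1 ^ 2) ⟨a, by simpa [ha] using ⟨b, hb, hab⟩⟩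
  simp only [Finset.mem_filter, and_imp, forall_exists_index] at hv hmax
  obtain ⟨hvW, c, hc, hvc⟩ := hv
  -- Identifying vertices with their positions, 2⟨v, v - w⟩ = |v|² - |w|² + |v - w|², and `v` is
  -- farthest from the origin.
  have hpos : ∀ w ∈ W, G.Adj v w → 0 < f v 0 * (f v 0 - f w 0) + f v 1 * (f v 1 - f w 1) := by
    intro w hw hvw
    have h1 := hmax w hw v hvW hvw.symm
    have h2 : 0 < (f v 0 - f w 0) ^ 2 + (f v 1 - f w 1) ^ 2 := by
      by_contra! h3
      apply h.injective.ne hvw.ne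
      ext i
      fin_cases i
      · change f v 0 = f w 0
        nlinarith [sq_nonneg (f v 0 - f w 0), sq_nonneg (f v 1 - f w 1)]
      · change f v 1 = f w 1
        nlinarith [sq_nonneg (f v 0 - f w 0), sq_nonneg (f v 1 - f w 1)]
    nlinarith
  -- Up to sign the quotient is the tangent of the angle between `w - v` and `-v`. All these
  -- directions lie in an open half-plane, so its maximum picks an extreme ray.
  obtain ⟨u, hu, hslope⟩ := (W.filter fun w => G.Adj v w).exists_max_image
    (fun w => (f v 0 * (f w 1 - f v 1) - f v 1 * (f w 0 - f v 0)) /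
      (f v 0 * (f v 0 - f w 0) + f v 1 * (f v 1 - f w 1))) ⟨c, by simp [hc, hvc]⟩
  simp only [Finset.mem_filter, and_imp] at hu hslope
  obtain ⟨huW, hvu⟩ := hu
  have hor : ∀ w ∈ W, G.Adj w v → G.Adj w u → 0 < orient (f v) (f u) (f w) := by
    intro w hw hwv hwu
    refine lt_of_le_of_ne ?_ (h.orient_ne_zero hvu hwv.symm hwu.symm).symm
    have h1 := hslope w hw hwv.symm
    have p1 := hpos w hw hwv.symm
    have p2 := hpos u huW hvu
    rw [div_le_div_iff₀ p1 p2] at h1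
    have hn : 0 < f v 0 ^ 2 + f v 1 ^ 2 := by
      by_contra! h3
      have z0 : f v 0 = 0 := by nlinarith [sq_nonneg (f v 0), sq_nonneg (f v 1)]
      have z1 : f v 1 = 0 := by nlinarith [sq_nonneg (f v 0), sq_nonneg (f v 1)]
      simp [z0, z1] at p1
    have h2 : 0 ≤ (f v 0 ^ 2 + f v 1 ^ 2) * orient (f v) (f u) (f w) := by
      unfold orient
      linear_combination h1
    exact nonneg_of_mul_nonneg_right h2 hn
  obtain ⟨x, hx, y, hy, hxy, hxv, hxu, hyv, hyu⟩ := hW2 v hvW u huW hvu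
  rcases h.same_side hvu hxv hxu hyv hyu hxy
    (mul_pos (hor x hx hxv hxu) (hor y hy hyv hyu)) with q | q
  · exact ⟨x, hx, v, hvW, u, huW, y, hy, q⟩
  · exact ⟨y, hy, v, hvW, u, huW, x, hx, q⟩

theorem IsInducedK222.exists_hexagon {S : Finset V} (hS : IsInducedK222 G S)
    (h : IsUnitDiskComplex G f) :
    ∃ p : Fin 6 → V, IsHexagon G f p ∧ (S : Set V) = Set.range p := by
  obtain ⟨q, hinj, hSq, hadj⟩ := isInducedK222_iff.1 hS
  have hm : ∀ v ∈ S, ∃ i, q i = v := fun v hv => by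
    have : v ∈ (S : Set V) := hv
    rwa [hSq] at this
  have hmem : ∀ i, q i ∈ S := fun i => by
    have : q i ∈ (S : Set V) := hSq ▸ Set.mem_range_self i
    exact this
  obtain ⟨p₀, h0, p₁, h1, p₂, h2, p₃, h3, hq⟩ := h.exists_isCrossingPath_mem S
    ⟨q 0, hmem 0, q 1, hmem 1, (hadj 0 1).2 (by decide)⟩ (by
      intro u hu v hv huv
      obtain ⟨i, rfl⟩ := hm u hu
      obtain ⟨j, rfl⟩ := hm v hv
      have key : ∀ i j : Fin 6, (j ≠ i ∧ j ≠ i + 3) → ∃ k : Fin 6, (i ≠ k ∧ i ≠ k + 3) ∧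
          (j ≠ k ∧ j ≠ k + 3) ∧ (i ≠ k + 3 ∧ i ≠ k + 3 + 3) ∧ (j ≠ k + 3 ∧ j ≠ k + 3 + 3) ∧
          k ≠ k + 3 := by decide
      obtain ⟨k, k1, k2, k3, k4, k5⟩ := key i j ((hadj i j).1 huv)
      exact ⟨q k, hmem k, q (k + 3), hmem _, hinj.ne k5, (hadj _ _).2 k1, (hadj _ _).2 k2,
        (hadj _ _).2 k3, (hadj _ _).2 k4⟩)
  obtain ⟨p, hp, hSp, -⟩ := hS.exists_isHexagon h hq h0 h1 h2 h3
  exact ⟨p, hp, hSp⟩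

/-! ### From crossing edges to crossing paths and back -/

theorem Crossing.symm {e₁ e₂ : Sym2 V} (hc : Crossing G f e₁ e₂) : Crossing G f e₂ e₁ :=
  ⟨hc.2.1, hc.1, hc.2.2.1.symm, by rw [Set.inter_comm]; exact hc.2.2.2⟩

theorem edgeInterior_mk (u v : V) : edgeInterior f s(u, v) = openSegment ℝ (f u) (f v) := by
  ext x
  constructor
  · rintro ⟨a, b, hab, hx⟩
    rcases Sym2.eq_iff.1 hab with ⟨rfl, rfl⟩ | ⟨rfl, rfl⟩
    · exact hx
    · rwa [openSegment_symm]
  · exact fun hx => ⟨u, v, rfl, hx⟩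

theorem IsUnitDiskComplex.not_openSegment_inter (h : IsUnitDiskComplex G f) {a b d : V}
    (hab : G.Adj a b) (had : G.Adj a d) (hbd : b ≠ d) :
    ¬ (openSegment ℝ (f a) (f b) ∩ openSegment ℝ (f a) (f d)).Nonempty := by
  intro hx
  rcases mem_segment_of_openSegment_inter hx with h1 | h1
  · exact h.not_mem_segment had hab.ne' hbd h1
  · exact h.not_mem_segment hab had.ne' hbd.symm h1

theorem Crossing.exists_isCrossingPath {e₁ e₂ : Sym2 V} (hc : Crossing G f e₁ e₂)
    (h : IsUnitDiskComplex G f) :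
    ∃ p₀ p₁ p₂ p₃ : V, IsCrossingPath G f p₀ p₁ p₂ p₃ ∧ e₁ = s(p₀, p₂) ∧ e₂ = s(p₁, p₃) := by
  induction e₁ using Sym2.ind with | _ a b
  induction e₂ using Sym2.ind with | _ c d
  obtain ⟨hab, hcd, hne, hx⟩ := hc
  rw [SimpleGraph.mem_edgeSet] at hab hcd
  rw [edgeInterior_mk, edgeInterior_mk] at hx
  have hac : a ≠ c := by
    rintro rfl
    exact h.not_openSegment_inter hab hcd (by rintro rfl; exact hne rfl) hx
  have had : a ≠ d := by
    rintro rfl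
    rw [openSegment_symm ℝ (f c)] at hx
    exact h.not_openSegment_inter hab hcd.symm (by rintro rfl; exact hne Sym2.eq_swap) hx
  have hbc : b ≠ c := by
    rintro rfl
    rw [openSegment_symm ℝ (f a)] at hx
    exact h.not_openSegment_inter hab.symm hcd (by rintro rfl; exact hne Sym2.eq_swap) hx
  have hbd : b ≠ d := by
    rintro rfl
    rw [openSegment_symm ℝ (f a), openSegment_symm ℝ (f c)] at hx
    exact h.not_openSegment_inter hab.symm hcd.symm (by rintro rfl; exact hne rfl) hx
  have hm : SegmentsMeet (f a) (f b) (f c) (f d) :=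
    hx.mono (Set.inter_subset_inter (openSegment_subset_segment _ _ _)
      (openSegment_subset_segment _ _ _))
  rcases h.exists_isCrossingPath hab hcd hac had hbc hbd hm with q | q | q | q
  · exact ⟨_, _, _, _, q, rfl, rfl⟩
  · exact ⟨_, _, _, _, q, rfl, Sym2.eq_swap⟩
  · exact ⟨_, _, _, _, q, Sym2.eq_swap, rfl⟩
  · exact ⟨_, _, _, _, q, Sym2.eq_swap, Sym2.eq_swap⟩

theorem IsCrossingPath.crossing {p₀ p₁ p₂ p₃ : V} (hq : IsCrossingPath G f p₀ p₁ p₂ p₃)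
    (h : IsUnitDiskComplex G f) : Crossing G f s(p₀, p₂) s(p₁, p₃) := by
  refine ⟨hq.adj02, hq.adj13, ?_, ?_⟩
  · intro he
    rcases Sym2.eq_iff.1 he with ⟨h1, -⟩ | ⟨h1, -⟩
    · exact hq.adj01.ne h1
    · exact hq.ne h1
  · rw [edgeInterior_mk, edgeInterior_mk]
    obtain ⟨x, h1, h2⟩ := hq.meet
    refine ⟨x, mem_openSegment_of_ne_left_right ?_ ?_ h1, mem_openSegment_of_ne_left_right ?_ ?_ h2⟩
    · rintro rfl
      exact h.not_mem_segment hq.adj13 hq.adj01.ne hq.ne h2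
    · rintro rfl
      exact h.not_mem_segment hq.adj13 hq.adj12.ne' hq.adj23.ne h2
    · rintro rfl
      exact h.not_mem_segment hq.adj02 hq.adj01.ne' hq.adj12.ne h1
    · rintro rfl
      exact h.not_mem_segment hq.adj02 hq.ne.symm hq.adj23.ne' h1

/-! ### Crossings and convexity of a hexagon -/

namespace IsHexagon

variable {p : Fin 6 → V}

/-- The pairs of short diagonals that cross in a hexagon. -/
def crossingPair {V : Type*} (p : Fin 6 → V) (i : Fin 6) : Sym2 (Sym2 V) :=
  s(s(p i, p (i + 2)), s(p (i + 1), p (i + 3)))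

theorem crossingPair_injective {p : Fin 6 → V} (hp : Function.Injective p) :
    Function.Injective (crossingPair p) := by
  have h1 : Function.Injective (crossingPair (id : Fin 6 → Fin 6)) := by
    unfold crossingPair
    decide
  have h2 : crossingPair p = Sym2.map (Sym2.map p) ∘ crossingPair id := by
    funext i
    simp [crossingPair]
  rw [h2]
  exact (Sym2.map.injective (Sym2.map.injective hp)).comp h1

theorem crossingPair_rotate (p : Fin 6 → V) (i k : Fin 6) :
    crossingPair (fun j => p (j + k)) i = crossingPair p (i + k) := by
  simp only [crossingPair, add_right_comm]

/-- The ends of the path are antipodal, which leaves eight choices for the middle vertices. Only the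
two runs along the boundary respect that sides are shorter than adjacent short diagonals. -/
theorem crossingPair_mem_of_zero (hp : IsHexagon G f p) (h : IsUnitDiskComplex G f)
    {j k l : Fin 6} (hq : IsCrossingPath G f (p 0) (p j) (p k) (p l)) :
    s(s(p 0, p k), s(p j, p l)) ∈ Set.range (crossingPair p) := by
  have aj := (hp.adj_iff _ _).1 hq.adj01
  have ak := (hp.adj_iff _ _).1 hq.adj02
  have ajk := (hp.adj_iff _ _).1 hq.adj12
  have al := fun hh => hq.not_adj ((hp.adj_iff 0 l).2 hh)
  have nl : l ≠ 0 := fun hh => hq.ne (hh ▸ rfl)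
  obtain rfl : l = 3 := by
    by_contra hl
    exact al ⟨nl, hl⟩
  have l1 := hq.fst_lt h
  have l2 := hq.last_lt h
  have l3 := hq.mid_lt_left h
  have l4 := hq.mid_lt_right h
  have key : ∀ j k : Fin 6, (j ≠ 0 ∧ j ≠ 0 + 3) → (k ≠ 0 ∧ k ≠ 0 + 3) → (k ≠ j ∧ k ≠ j + 3) →
      (j = 1 ∧ k = 2) ∨ (j = 1 ∧ k = 5) ∨ (j = 2 ∧ k = 1) ∨ (j = 2 ∧ k = 4) ∨
      (j = 4 ∧ k = 2) ∨ (j = 4 ∧ k = 5) ∨ (j = 5 ∧ k = 1) ∨ (j = 5 ∧ k = 4) := by decide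
  rcases key j k aj ak ajk with ⟨rfl, rfl⟩ | ⟨rfl, rfl⟩ | ⟨rfl, rfl⟩ | ⟨rfl, rfl⟩ | ⟨rfl, rfl⟩ |
    ⟨rfl, rfl⟩ | ⟨rfl, rfl⟩ | ⟨rfl, rfl⟩
  · exact ⟨0, rfl⟩
  · have m := hp.side_lt h 5
    change dist (f (p 5)) (f (p 0)) < dist (f (p 5)) (f (p 1)) at m
    grind [dist_comm]
  · have m := hp.side_lt h 0
    change dist (f (p 0)) (f (p 1)) < dist (f (p 0)) (f (p 2)) at m
    grind [dist_comm]
  · have m := hp.side_lt h 2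
    change dist (f (p 2)) (f (p 3)) < dist (f (p 2)) (f (p 4)) at m
    grind [dist_comm]
  · have m := hp.side_lt' h 2
    change dist (f (p 3)) (f (p 4)) < dist (f (p 2)) (f (p 4)) at m
    grind [dist_comm]
  · have m := hp.side_lt' h 4
    change dist (f (p 5)) (f (p 0)) < dist (f (p 4)) (f (p 0)) at m
    grind [dist_comm]
  · have m := hp.side_lt' h 5
    change dist (f (p 0)) (f (p 1)) < dist (f (p 5)) (f (p 1)) at m
    grind [dist_comm]
  · refine ⟨3, ?_⟩
    change s(s(p 3, p 5), s(p 4, p 0)) = s(s(p 0, p 4), s(p 5, p 3))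
    rw [Sym2.eq_swap, Sym2.eq_swap (a := p 0), Sym2.eq_swap (a := p 5)]

theorem crossingPair_mem (hp : IsHexagon G f p) (h : IsUnitDiskComplex G f)
    {i j k l : Fin 6} (hq : IsCrossingPath G f (p i) (p j) (p k) (p l)) :
    s(s(p i, p k), s(p j, p l)) ∈ Set.range (crossingPair p) := by
  have hz := (hp.rotate i).crossingPair_mem_of_zero h (j := j - i) (k := k - i) (l := l - i)
    (by simpa only [zero_add, sub_add_cancel] using hq)
  simp only [zero_add, sub_add_cancel] at hz
  obtain ⟨m, hm⟩ := hz
  exact ⟨m + i, by rw [← hm, crossingPair_rotate]⟩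

theorem crossingPairsIn_eq (hp : IsHexagon G f p) (h : IsUnitDiskComplex G f) {S : Finset V}
    (hS : (S : Set V) = Set.range p) : crossingPairsIn G f S = Set.range (crossingPair p) := by
  have hm : ∀ v, v ∈ S ↔ ∃ i, p i = v := fun v => by
    rw [← Finset.mem_coe, hS]; rfl
  ext P
  constructor
  · rintro ⟨⟨e₁, e₂, rfl, hc⟩, hP⟩
    obtain ⟨p₀, p₁, p₂, p₃, hq, rfl, rfl⟩ := hc.exists_isCrossingPath h
    obtain ⟨i, rfl⟩ := (hm p₀).1 (hP _ (Sym2.mem_mk_left _ _) _ (Sym2.mem_mk_left _ _))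
    obtain ⟨j, rfl⟩ := (hm p₁).1 (hP _ (Sym2.mem_mk_right _ _) _ (Sym2.mem_mk_left _ _))
    obtain ⟨k, rfl⟩ := (hm p₂).1 (hP _ (Sym2.mem_mk_left _ _) _ (Sym2.mem_mk_right _ _))
    obtain ⟨l, rfl⟩ := (hm p₃).1 (hP _ (Sym2.mem_mk_right _ _) _ (Sym2.mem_mk_right _ _))
    exact hp.crossingPair_mem h hq
  · rintro ⟨i, rfl⟩
    refine ⟨⟨_, _, rfl, (hp i).crossing h⟩, ?_⟩
    simp [crossingPair, hm]

theorem ncard_crossingPairsIn (hp : IsHexagon G f p) (h : IsUnitDiskComplex G f) {S : Finset V}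
    (hS : (S : Set V) = Set.range p) : (crossingPairsIn G f S).ncard = 6 := by
  rw [hp.crossingPairsIn_eq h hS, ← Set.image_univ,
    Set.ncard_image_of_injective _ (crossingPair_injective hp.injective), Set.ncard_univ]
  simp

theorem mul_pos_of_mul_pos {a b c : ℝ} (h1 : 0 < a * b) (h2 : 0 < b * c) : 0 < a * c := by
  have h3 : 0 < b ^ 2 * (a * c) := by
    have := mul_pos h1 h2
    linarith
  exact (pos_iff_pos_of_mul_pos h3).1 (by
    have : b ≠ 0 := by rintro rfl; simp at h1
    positivity)

/-- All other vertices of a hexagon lie on the same side of each of its sides. -/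
theorem orient_pos (hp : IsHexagon G f p) (h : IsUnitDiskComplex G f) {i j : Fin 6}
    (hji : j ≠ i) (hji1 : j ≠ i + 1) :
    0 < orient (f (p 0)) (f (p 1)) (f (p 2)) * orient (f (p i)) (f (p (i + 1))) (f (p j)) := by
  -- Successive corners turn the same way, as the ends of a crossing path lie on one side of its
  -- middle edge.
  have step : ∀ i : Fin 6, 0 < orient (f (p i)) (f (p (i + 1))) (f (p (i + 2))) *
      orient (f (p (i + 1))) (f (p (i + 1 + 1))) (f (p (i + 1 + 2))) := by
    intro i
    have e : ∀ i : Fin 6, i + 1 + 1 = i + 2 ∧ i + 1 + 2 = i + 3 := by decide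
    rw [(e i).1, (e i).2]
    have := (hp i).orient_mid_mul_pos h
    rwa [orient_rotate] at this
  have t0 : ∀ i : Fin 6, 0 < orient (f (p 0)) (f (p 1)) (f (p 2)) *
      orient (f (p i)) (f (p (i + 1))) (f (p (i + 2))) := by
    have s0 := step 0
    have s1 := mul_pos_of_mul_pos s0 (step 1)
    have s2 := mul_pos_of_mul_pos s1 (step 2)
    have s3 := mul_pos_of_mul_pos s2 (step 3)
    have s4 := mul_pos_of_mul_pos s3 (step 4)
    have s5 := mul_pos_of_mul_pos s4 (step 5)
    intro i
    fin_cases i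
    exacts [s5, s0, s1, s2, s3, s4]
  have e : ∀ i j : Fin 6, j ≠ i → j ≠ i + 1 → j = i + 2 ∨ j = i + 3 ∨ i = j + 2 ∨ i = j + 1 := by
    decide
  rcases e i j hji hji1 with rfl | rfl | rfl | rfl
  · exact t0 i
  · have e1 : ∀ i : Fin 6, i + 1 + 1 = i + 2 ∧ i + 1 + 2 = i + 3 := by decide
    have h1 := t0 (i + 1)
    rw [(e1 i).1, (e1 i).2] at h1
    refine mul_pos_of_mul_pos h1 ?_
    have := (hp i).orient_mul_neg h
    rw [orient_rotate, orient_swap_right (f (p (i + 1))) (f (p (i + 2)))] at this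
    linarith
  · have e1 : ∀ j : Fin 6, j + 2 + 1 = j + 3 := by decide
    rw [e1]
    refine mul_pos_of_mul_pos (t0 j) ?_
    have := (hp j).reverse.orient_mul_neg h
    rw [orient_swap_right (f (p (j + 2))) (f (p (j + 3))),
      ← orient_rotate (f (p (j + 2))) (f (p j))] at this
    linarith
  · have e1 : ∀ j : Fin 6, j + 1 + 1 = j + 2 := by decide
    rw [e1, orient_rotate (f (p j))]
    exact t0 j

theorem convexIndependent (hp : IsHexagon G f p) (h : IsUnitDiskComplex G f) {S : Finset V}
    (hS : (S : Set V) = Set.range p) : ConvexIndependent ℝ (fun v : S => f v) := by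
  have hm : ∀ v, v ∈ S ↔ ∃ i, p i = v := fun v => by
    rw [← Finset.mem_coe, hS]; rfl
  rintro s ⟨x, hx⟩ hxs
  obtain ⟨i, rfl⟩ := (hm x).1 hx
  by_contra hn
  set σ := orient (f (p 0)) (f (p 1)) (f (p 2)) with hσ
  -- Each of the two side functionals at `p i` also vanishes at a neighbouring vertex; their sum is
  -- positive at all five other vertices and zero at `p i`.
  let L : EuclideanSpace ℝ (Fin 2) → ℝ := fun y =>
    σ * orient (f (p (i - 1))) (f (p i)) y + σ * orient (f (p i)) (f (p (i + 1))) y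
  have hconv : Convex ℝ {y | 0 < L y} := by
    intro y hy z hz a b ha hb hab
    have e : L (a • y + b • z) = a * L y + b * L z := by
      simp only [L, orient_combo _ _ _ _ hab]
      ring
    simp only [Set.mem_ofPred_eq] at hy hz ⊢
    rw [e]
    rcases ha.eq_or_lt with rfl | ha
    · obtain rfl : b = 1 := by linarith
      simpa using hz
    · have := mul_pos ha hy
      have := mul_nonneg hb hz.le
      linarith
  have hsub : (fun v : S => f v) '' s ⊆ {y | 0 < L y} := by
    rintro _ ⟨⟨v, hv⟩, hvs, rfl⟩
    obtain ⟨j, rfl⟩ := (hm v).1 hv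
    have hji : j ≠ i := by
      rintro rfl
      exact hn hvs
    have h1 : j ≠ i - 1 → 0 < σ * orient (f (p (i - 1))) (f (p i)) (f (p j)) := by
      intro hj
      have := hp.orient_pos h hj (by simpa using hji)
      rwa [sub_add_cancel] at this
    have h2 : j ≠ i + 1 → 0 < σ * orient (f (p i)) (f (p (i + 1))) (f (p j)) :=
      hp.orient_pos h hji
    change 0 < L (f (p j))
    simp only [L]
    by_cases j1 : j = i - 1
    · have e : ∀ i : Fin 6, i - 1 ≠ i + 1 := by decide
      have := h2 (j1 ▸ e i)
      rw [j1, orient_left_self, ← j1]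
      linarith
    · by_cases j2 : j = i + 1
      · have := h1 j1
        rw [j2, orient_right_self, ← j2]
        linarith
      · exact add_pos (h1 j1) (h2 j2)
  have hpos : 0 < L (f (p i)) := convexHull_min hsub hconv hxs
  simp [L, orient_left_self, orient_right_self] at hpos

end IsHexagon

/-! ### An edge lies in at most two octahedra -/

namespace IsHexagon

variable {p q : Fin 6 → V} {S T : Finset V}

theorem mem_of_coe_eq_range (hS : (S : Set V) = Set.range p) (i : Fin 6) : p i ∈ S := by
  rw [← Finset.mem_coe, hS]
  exact Set.mem_range_self i

/-- On the given side of the common edge both hexagons have two further vertices, labelled 2 and 5.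
Only two common neighbours fit there, so the pairs coincide and a crossing path is shared. -/
theorem eq_of_side (hp : IsHexagon G f p) (hq : IsHexagon G f q) (h : IsUnitDiskComplex G f)
    (hS : (S : Set V) = Set.range p) (hT : (T : Set V) = Set.range q)
    (h0 : q 0 = p 0) (h1 : q 1 = p 1)
    (hs : 0 < orient (f (p 0)) (f (p 1)) (f (p 2)) * orient (f (p 0)) (f (p 1)) (f (q 2))) :
    S = T := by
  have p5 : IsCrossingPath G f (p 5) (p 0) (p 1) (p 2) := hp 5
  have q5 : IsCrossingPath G f (q 5) (p 0) (p 1) (q 2) := h1 ▸ h0 ▸ hq 5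
  have s1 := p5.orient_mid_mul_pos h
  have s2 := q5.orient_mid_mul_pos h
  rw [mul_comm] at s1 s2
  have key : ∀ w, G.Adj w (p 0) → G.Adj w (p 1) → p 2 ≠ w →
      0 < orient (f (p 0)) (f (p 1)) (f (p 2)) * orient (f (p 0)) (f (p 1)) (f w) → p 5 = w :=
    fun w w0 w1 w2 hw => h.eq_of_same_side p5.adj12 p5.adj13.symm p5.adj23.symm p5.adj01 p5.adj02
      w0 w1 p5.ne.symm w2 s1 hw
  have k2 := key (q 2) q5.adj13.symm q5.adj23.symm
  have k5 := key (q 5) q5.adj01 q5.adj02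
  have hmem : p 2 ∈ T ∧ p 5 ∈ T := by
    by_cases e2 : p 2 = q 2
    · refine ⟨e2 ▸ mem_of_coe_eq_range hT 2, ?_⟩
      rw [k5 (e2 ▸ q5.ne.symm) (mul_pos_of_mul_pos hs s2)]
      exact mem_of_coe_eq_range hT 5
    · have e5 := k2 e2 hs
      refine ⟨?_, e5 ▸ mem_of_coe_eq_range hT 2⟩
      by_cases e3 : p 2 = q 5
      · exact e3 ▸ mem_of_coe_eq_range hT 5
      · exact absurd ((k5 e3 (mul_pos_of_mul_pos hs s2)).symm.trans e5) q5.ne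
  exact p5.eq_of_isInducedK222 h (hp.isInducedK222 hS) (mem_of_coe_eq_range hS 5)
    (mem_of_coe_eq_range hS 0) (mem_of_coe_eq_range hS 1) (mem_of_coe_eq_range hS 2)
    (hq.isInducedK222 hT) hmem.2 (h0 ▸ mem_of_coe_eq_range hT 0) (h1 ▸ mem_of_coe_eq_range hT 1)
    hmem.1

/-- The only common neighbours of the diagonal's ends are `p 1` and `p 4`. These lie on different
sides, since otherwise the diagonal would be a short middle edge; so `q 1 = p 1`, and then `q 3 = p
3`. -/
theorem eq_of_diagonal (hp : IsHexagon G f p) (hq : IsHexagon G f q) (h : IsUnitDiskComplex G f)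
    (hS : (S : Set V) = Set.range p) (hT : (T : Set V) = Set.range q)
    (h0 : q 0 = p 0) (h2 : q 2 = p 2)
    (hs : 0 < orient (f (p 0)) (f (p 2)) (f (p 1)) * orient (f (p 0)) (f (p 2)) (f (q 1))) :
    S = T := by
  have adj := fun i j => (hp.adj_iff i j).2
  have p0 : IsCrossingPath G f (p 0) (p 1) (p 2) (p 3) := hp 0
  have q0 : IsCrossingPath G f (p 0) (q 1) (p 2) (q 3) := h2 ▸ h0 ▸ hq 0
  have h1 : q 1 = p 1 := by
    by_contra hne
    have h40 : G.Adj (p 4) (p 0) := adj _ _ (by decide)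
    have h42 : G.Adj (p 4) (p 2) := adj _ _ (by decide)
    have h14 : p 4 ≠ p 1 := hp.injective.ne (by decide)
    have e := p0.eq_of_adj_diagonal h h14 h40 h42 hne q0.adj01.symm q0.adj12
    rw [← e] at hs
    have l1 := p0.fst_lt h
    have l2 := p0.mid_lt_left h
    rcases h.same_side p0.adj02 p0.adj01.symm p0.adj12 h40 h42 h14.symm hs with c | c
    · have := c.mid_lt_left h
      linarith
    · have := c.mid_lt_right h
      linarith
  have h3 : p 3 = q 3 := by
    rw [h1] at q0
    exact h.eq_of_same_side p0.adj12 p0.adj01 p0.adj02 p0.adj13.symm p0.adj23.symm q0.adj13.symm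
      q0.adj23.symm p0.ne q0.ne (p0.orient_mid_mul_pos h) (q0.orient_mid_mul_pos h)
  exact p0.eq_of_isInducedK222 h (hp.isInducedK222 hS) (mem_of_coe_eq_range hS 0)
    (mem_of_coe_eq_range hS 1) (mem_of_coe_eq_range hS 2) (mem_of_coe_eq_range hS 3)
    (hq.isInducedK222 hT) (h0 ▸ mem_of_coe_eq_range hT 0) (h1 ▸ mem_of_coe_eq_range hT 1)
    (h2 ▸ mem_of_coe_eq_range hT 2) (h3 ▸ mem_of_coe_eq_range hT 3)

/-- A side of a hexagon is not a short diagonal of a hexagon. -/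
theorem side_ne_diagonal (hp : IsHexagon G f p) (hq : IsHexagon G f q)
    (h : IsUnitDiskComplex G f) (h0 : q 0 = p 0) (h2 : q 2 = p 1) : False := by
  have p5 : IsCrossingPath G f (p 5) (p 0) (p 1) (p 2) := hp 5
  have q0 : IsCrossingPath G f (p 0) (q 1) (p 1) (q 3) := h2 ▸ h0 ▸ hq 0
  have l1 := p5.mid_lt_left h
  have l2 := p5.mid_lt_right h
  have l3 := q0.fst_lt h
  have l4 := q0.mid_lt_left h
  -- By the length comparisons `q 1` is neither `p 2` nor `p 5`, so the diagonal would have two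
  -- common neighbours besides `q 1`, one too many.
  have n2 : p 2 ≠ q 1 := by
    intro e
    rw [e] at l2
    linarith
  have n5 : p 5 ≠ q 1 := by
    intro e
    rw [e] at l1
    linarith
  exact p5.ne (q0.eq_of_adj_diagonal h n5 p5.adj01 p5.adj02 n2 p5.adj13.symm p5.adj23.symm)

/-- A hexagon can be labelled such that a given edge joins the label `0` to the label `1` or `2`. -/
theorem exists_normal (hp : IsHexagon G f p) {u v : V} (hu : u ∈ Set.range p)
    (hv : v ∈ Set.range p) (huv : G.Adj u v) :
    ∃ q : Fin 6 → V, IsHexagon G f q ∧ Set.range q = Set.range p ∧ q 0 = u ∧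
      (q 1 = v ∨ q 2 = v) := by
  obtain ⟨i, rfl⟩ := hu
  obtain ⟨j, rfl⟩ := hv
  have key : ∀ i j : Fin 6, (j ≠ i ∧ j ≠ i + 3) →
      j = 1 + i ∨ j = 2 + i ∨ j = i - 1 ∨ j = i - 2 := by decide
  rcases key i j ((hp.adj_iff i j).1 huv) with rfl | rfl | rfl | rfl
  · exact ⟨_, hp.rotate i, range_rotate p i, by simp, Or.inl rfl⟩
  · exact ⟨_, hp.rotate i, range_rotate p i, by simp, Or.inr rfl⟩
  · exact ⟨_, hp.reverse i, range_reverse p i, by simp, Or.inl rfl⟩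
  · exact ⟨_, hp.reverse i, range_reverse p i, by simp, Or.inr rfl⟩

end IsHexagon

/-- The octahedron is recovered from one bit: the side of the edge that contains label 2 when the
edge is a hexagon side, or label 1 when it is a short diagonal. The two roles never mix. -/
theorem IsUnitDiskComplex.ncard_isInducedK222_le [Finite V] (h : IsUnitDiskComplex G f) {u v : V}
    (huv : G.Adj u v) : {S : Finset V | IsInducedK222 G S ∧ u ∈ S ∧ v ∈ S}.ncard ≤ 2 := by
  classical
  have hnorm : ∀ S : Finset V, IsInducedK222 G S ∧ u ∈ S ∧ v ∈ S → ∃ s : Bool, ∃ q : Fin 6 → V,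
      IsHexagon G f q ∧ (S : Set V) = Set.range q ∧ q 0 = u ∧
      ((q 1 = v ∧ (s = true ↔ 0 < orient (f u) (f v) (f (q 2)))) ∨
        (q 2 = v ∧ (s = true ↔ 0 < orient (f u) (f v) (f (q 1))))) := by
    rintro S ⟨hS, hu, hv⟩
    obtain ⟨p, hp, hSp⟩ := hS.exists_hexagon h
    have hu' : u ∈ (S : Set V) := hu
    have hv' : v ∈ (S : Set V) := hv
    rw [hSp] at hu' hv'
    obtain ⟨q, hq, hqp, h0, h1 | h2⟩ := hp.exists_normal hu' hv' huv
    · exact ⟨decide (0 < orient (f u) (f v) (f (q 2))), q, hq, hSp.trans hqp.symm, h0,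
        Or.inl ⟨h1, by simp⟩⟩
    · exact ⟨decide (0 < orient (f u) (f v) (f (q 1))), q, hq, hSp.trans hqp.symm, h0,
        Or.inr ⟨h2, by simp⟩⟩
  have hsign : ∀ (s : Bool) (a b : ℝ), a ≠ 0 → b ≠ 0 → (s = true ↔ 0 < a) → (s = true ↔ 0 < b) →
      0 < a * b := by
    intro s a b ha hb h1 h2
    rcases lt_or_gt_of_ne ha with ha' | ha'
    · exact mul_pos_of_neg_of_neg ha' (lt_of_le_of_ne (not_lt.1 fun hb' =>
        ha'.not_gt (h1.1 (h2.2 hb'))) hb)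
    · exact mul_pos ha' (h2.1 (h1.2 ha'))
  choose! s hs using hnorm
  have hinj : Set.InjOn s {S : Finset V | IsInducedK222 G S ∧ u ∈ S ∧ v ∈ S} := by
    intro S hS T hT hST
    obtain ⟨p, hp, hSp, rfl, hpv⟩ := hs S hS
    obtain ⟨q, hq, hTq, h0, hqv⟩ := hs T hT
    rw [← hST] at hqv
    have o1 := h.orient_ne_zero (hp 0).adj01 (hp 0).adj02 (hp 0).adj12
    have o2 := h.orient_ne_zero (hp 0).adj02 (hp 0).adj01 (hp 0).adj12.symm
    have o3 := h.orient_ne_zero (hq 0).adj01 (hq 0).adj02 (hq 0).adj12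
    have o4 := h.orient_ne_zero (hq 0).adj02 (hq 0).adj01 (hq 0).adj12.symm
    simp only [zero_add] at o1 o2 o3 o4
    rw [h0] at o3 o4
    rcases hpv with ⟨h1, hp2⟩ | ⟨h1, hp2⟩ <;> rcases hqv with ⟨h2, hq2⟩ | ⟨h2, hq2⟩
    · subst h1
      rw [h2] at o3
      exact hp.eq_of_side hq h hSp hTq h0 h2 (hsign _ _ _ o1 o3 hp2 hq2)
    · exact (hp.side_ne_diagonal hq h h0 (h2.trans h1.symm)).elim
    · exact (hq.side_ne_diagonal hp h h0.symm (h1.trans h2.symm)).elim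
    · subst h1
      rw [h2] at o4
      exact hp.eq_of_diagonal hq h hSp hTq h0 h2 (hsign _ _ _ o2 o4 hp2 hq2)
  have := Set.ncard_le_ncard_of_injOn (t := (Set.univ : Set Bool)) s (fun _ _ => Set.mem_univ _)
    hinj
  simpa [Set.ncard_univ] using this

/-! ### Edge degrees and the final count -/

theorem edgeDegree_le_ncard [Finite V] (G : SimpleGraph V) {u v : V} (huv : u ≠ v) :
    edgeDegree G s(u, v) ≤ {x | G.Adj x u ∧ G.Adj x v}.ncard := by
  classical
  refine (Set.ncard_le_ncard (t := (fun x => ({u, v, x} : Finset V)) ''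
    {x | G.Adj x u ∧ G.Adj x v}) ?_).trans (Set.ncard_image_le)
  rintro t ⟨ht, hm⟩
  have hu : u ∈ t := hm u (Sym2.mem_mk_left _ _)
  have hv : v ∈ t := hm v (Sym2.mem_mk_right _ _)
  have hcard : ((t.erase u).erase v).card = 1 := by
    rw [Finset.card_erase_of_mem (Finset.mem_erase.2 ⟨huv.symm, hv⟩), Finset.card_erase_of_mem hu,
      ht.card_eq]
  obtain ⟨x, hx⟩ := Finset.card_eq_one.1 hcard
  have hxm : x ∈ (t.erase u).erase v := by simp [hx]
  simp only [Finset.mem_erase] at hxm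
  refine ⟨x, ⟨ht.isClique hxm.2.2 hu hxm.2.1, ht.isClique hxm.2.2 hv hxm.1⟩, ?_⟩
  change {u, v, x} = t
  rw [← Finset.insert_erase hu, ← Finset.insert_erase (Finset.mem_erase.2 ⟨huv.symm, hv⟩), hx]

/-- Degree at least two enters only as a common neighbour avoiding a prescribed vertex. -/
theorem IsUnitDiskRealization.isUnitDiskComplex [Finite V] (hf : IsUnitDiskRealization G f)
    (hclique : G.cliqueNum = 3) (hdeg : ∀ e ∈ G.edgeSet, 2 ≤ edgeDegree G e) :
    IsUnitDiskComplex G f where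
  injective := hf.1
  adj_iff := hf.2
  cliqueFree a b c d hab hac had hbc hbd hcd := by
    classical
    have h4 : G.IsNClique 4 {a, b, c, d} := by
      refine (SimpleGraph.is3Clique_triple_iff.2 ⟨hbc, hbd, hcd⟩).insert ?_
      simp [hab, hac, had]
    have := h4.isClique.card_le_cliqueNum
    rw [h4.card_eq, hclique] at this
    omega
  exists_ne u v w huv := by
    have h2 := (hdeg s(u, v) huv).trans (edgeDegree_le_ncard G huv.ne)
    obtain ⟨x, hx, hxw⟩ := Set.exists_ne_of_one_lt_ncard h2 w
    exact ⟨x, hxw, hx⟩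

theorem IsUnitDiskComplex.exists_isInducedK222_of_three_le [Finite V] (h : IsUnitDiskComplex G f)
    {u v : V} (huv : G.Adj u v) (hdeg : 3 ≤ edgeDegree G s(u, v)) :
    ∃ S : Finset V, IsInducedK222 G S ∧ u ∈ S ∧ v ∈ S := by
  have h3 := hdeg.trans (edgeDegree_le_ncard G huv.ne)
  obtain ⟨x, hx, y, hy, z, hz, hxy, hxz, hyz⟩ := (Set.two_lt_ncard (Set.toFinite _)).1 h3
  have ox := h.orient_ne_zero huv hx.1.symm hx.2.symm
  have oy := h.orient_ne_zero huv hy.1.symm hy.2.symm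
  have oz := h.orient_ne_zero huv hz.1.symm hz.2.symm
  have key : ∀ x y : V, IsCrossingPath G f x u v y →
      ∃ S : Finset V, IsInducedK222 G S ∧ u ∈ S ∧ v ∈ S := by
    intro x y hq
    obtain ⟨p, hp, -, rfl, rfl, -⟩ := hq.exists_isHexagon h
    obtain ⟨S, hS, hm⟩ := hp.exists_isInducedK222
    exact ⟨S, hS, hm _, hm _⟩
  have key2 : ∀ x y : V, G.Adj x u ∧ G.Adj x v → G.Adj y u ∧ G.Adj y v → x ≠ y →
      0 < orient (f u) (f v) (f x) * orient (f u) (f v) (f y) →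
      ∃ S : Finset V, IsInducedK222 G S ∧ u ∈ S ∧ v ∈ S := by
    intro x y hx hy hxy ho
    exact (h.same_side huv hx.1 hx.2 hy.1 hy.2 hxy ho).elim (key _ _) (key _ _)
  rcases lt_or_gt_of_ne ox with ox | ox <;> rcases lt_or_gt_of_ne oy with oy | oy <;>
    rcases lt_or_gt_of_ne oz with oz | oz
  all_goals first
    | exact key2 x y hx hy hxy (mul_pos_of_neg_of_neg ox oy)
    | exact key2 x y hx hy hxy (mul_pos ox oy)
    | exact key2 x z hx hz hxz (mul_pos_of_neg_of_neg ox oz)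
    | exact key2 x z hx hz hxz (mul_pos ox oz)
    | exact key2 y z hy hz hyz (mul_pos_of_neg_of_neg oy oz)
    | exact key2 y z hy hz hyz (mul_pos oy oz)

theorem Crossing.existsUnique_isInducedK222 {e₁ e₂ : Sym2 V} (hc : Crossing G f e₁ e₂)
    (h : IsUnitDiskComplex G f) :
    ∃! S : Finset V, IsInducedK222 G S ∧ (∀ v ∈ e₁, v ∈ S) ∧ (∀ v ∈ e₂, v ∈ S) := by
  obtain ⟨p₀, p₁, p₂, p₃, hq, rfl, rfl⟩ := hc.exists_isCrossingPath h
  obtain ⟨p, hp, rfl, rfl, rfl, rfl⟩ := hq.exists_isHexagon h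
  obtain ⟨S, hS, hm⟩ := hp.exists_isInducedK222
  refine ⟨S, ⟨hS, by simp [hm], by simp [hm]⟩, ?_⟩
  rintro T ⟨hT, h1, h2⟩
  exact hq.eq_of_isInducedK222 h hT (h1 _ (by simp)) (h2 _ (by simp)) (h1 _ (by simp))
    (h2 _ (by simp)) hS (hm _) (hm _) (hm _) (hm _)

theorem IsUnitDiskComplex.ncard_crossingPairs [Finite V] (h : IsUnitDiskComplex G f) :
    6 * {S : Finset V | IsInducedK222 G S}.ncard = (crossingPairs G f).ncard := by
  classical
  have hfin : (crossingPairs G f).Finite := Set.toFinite _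
  have hfin' : {S : Finset V | IsInducedK222 G S}.Finite := Set.toFinite _
  have huniq : ∀ P ∈ crossingPairs G f, ∃ S : Finset V, IsInducedK222 G S ∧
      (∀ e ∈ P, ∀ v ∈ e, v ∈ S) ∧ ∀ T, IsInducedK222 G T → (∀ e ∈ P, ∀ v ∈ e, v ∈ T) → T = S := by
    rintro _ ⟨e₁, e₂, rfl, hc⟩
    obtain ⟨S, ⟨hS, h1, h2⟩, hu⟩ := hc.existsUnique_isInducedK222 h
    refine ⟨S, hS, by simpa using ⟨h1, h2⟩, fun T hT hm => hu T ⟨hT, ?_, ?_⟩⟩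
    · exact hm _ (Sym2.mem_mk_left _ _)
    · exact hm _ (Sym2.mem_mk_right _ _)
  choose! g hg1 hg2 hg3 using huniq
  -- Counting along `g`: by uniqueness the fibre over `S` is the set of crossing pairs inside `S`,
  -- which has six elements.
  rw [Set.ncard_eq_toFinset_card _ hfin, Set.ncard_eq_toFinset_card _ hfin',
    Finset.card_eq_sum_card_fiberwise (f := g) (t := hfin'.toFinset)
      (fun P hP => by
        rw [Finset.mem_coe, Set.Finite.mem_toFinset] at hP ⊢
        exact hg1 P hP),
    Finset.sum_const_nat (m := 6), mul_comm]
  intro S hS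
  rw [Set.Finite.mem_toFinset] at hS
  obtain ⟨p, hp, hSp⟩ := IsInducedK222.exists_hexagon hS h
  rw [← hp.ncard_crossingPairsIn h hSp, ← Set.ncard_coe_finset]
  congr 1
  ext P
  simp only [Finset.coe_filter, Set.Finite.mem_toFinset]
  constructor
  · rintro ⟨hP, rfl⟩
    exact ⟨hP, hg2 P hP⟩
  · rintro ⟨hP, hm⟩
    exact ⟨hP, (hg3 P hP S hS hm).symm⟩

end

theorem theoremD {V : Type*} [Finite V] (G : SimpleGraph V)
    (f : V → EuclideanSpace ℝ (Fin 2)) (hf : IsUnitDiskRealization G f)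
    (hconn : G.Connected) (hclique : G.cliqueNum = 3)
    (hdeg : ∀ e ∈ G.edgeSet, 2 ≤ edgeDegree G e) :
    -- there is an induced `K_{2,2,2}`
    (∃ S : Finset V, IsInducedK222 G S) ∧
    -- every edge lies in at most two induced copies
    (∀ e ∈ G.edgeSet, {S : Finset V | IsInducedK222 G S ∧ ∀ v ∈ e, v ∈ S}.ncard ≤ 2) ∧
    -- every edge of degree at least three lies in some induced copy
    (∀ e ∈ G.edgeSet, 3 ≤ edgeDegree G e →
      ∃ S : Finset V, IsInducedK222 G S ∧ ∀ v ∈ e, v ∈ S) ∧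
    -- every pair of crossing edges lies in exactly one induced copy
    (∀ e₁ e₂ : Sym2 V, Crossing G f e₁ e₂ →
      ∃! S : Finset V, IsInducedK222 G S ∧ (∀ v ∈ e₁, v ∈ S) ∧ (∀ v ∈ e₂, v ∈ S)) ∧
    -- every induced copy is drawn on the vertices of a convex hexagon, with six pairs of
    -- crossing edges
    (∀ S : Finset V, IsInducedK222 G S →
      ConvexIndependent ℝ (fun v : S => f v) ∧ (crossingPairsIn G f S).ncard = 6) ∧
    -- the number of induced copies is one sixth of the number of pairs of crossing edges
    6 * {S : Finset V | IsInducedK222 G S}.ncard = (crossingPairs G f).ncard := by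
  have h := hf.isUnitDiskComplex hclique hdeg
  refine ⟨?_, ?_, ?_, fun e₁ e₂ hc => hc.existsUnique_isInducedK222 h, ?_, h.ncard_crossingPairs⟩
  · classical
    have := Fintype.ofFinite V
    obtain ⟨s, hs⟩ := G.exists_isNClique_cliqueNum
    rw [hclique, SimpleGraph.is3Clique_iff] at hs
    obtain ⟨a, b, -, hab, -⟩ := hs
    obtain ⟨p₀, -, p₁, -, p₂, -, p₃, -, hq⟩ := h.exists_isCrossingPath_mem Finset.univ
      ⟨a, Finset.mem_univ _, b, Finset.mem_univ _, hab⟩ (fun u _ v _ huv => by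
        obtain ⟨x, -, hxu, hxv⟩ := h.exists_ne u v u huv
        obtain ⟨y, hyx, hyu, hyv⟩ := h.exists_ne u v x huv
        exact ⟨x, Finset.mem_univ _, y, Finset.mem_univ _, hyx.symm, hxu, hxv, hyu, hyv⟩)
    obtain ⟨p, hp, -⟩ := hq.exists_isHexagon h
    obtain ⟨S, hS, -⟩ := hp.exists_isInducedK222
    exact ⟨S, hS⟩
  · intro e he
    induction e using Sym2.ind with | _ u v
    simpa using h.ncard_isInducedK222_le he
  · intro e he hd
    induction e using Sym2.ind with | _ u v
    simpa using h.exists_isInducedK222_of_three_le he hd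
  · intro S hS
    obtain ⟨p, hp, hSp⟩ := hS.exists_hexagon h
    exact ⟨hp.convexIndependent h hSp, hp.ncard_crossingPairsIn h hSp⟩
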